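/- Let $p$ be a prime. A $p$-adic distribution on $\mathbb{Z}_p$ is a finitely additive function $\mu$ from the set of compact-open subsets of $\mathbb{Z}_p$ to $\mathbb{Q}_p$; it is a $p$-adic measure if it is bounded, and then it defines a continuous $\mathbb{Q}_p$-linear functional on the continuous functions $f\colon\mathbb{Z}_p\to\mathbb{Q}_p$ by $$\mu(f)=\int_{\mathbb{Z}_p} f\,d\mu:=\lim_{N\to\infty}\sum_{b=0}^{p^N-1} f(b)\,\mu(b+p^N\mathbb{Z}_p).$$ For an integer $n\ge 0$ let $\mu_n$ be the $n$-th Bernoulli distribution, i.e. the unique $p$-adic distribution such that $$\mu_n(b+p^N\mathbb{Z}_p)=p^{N(n-1)}\,\mathbb{B}_n\!\left(\left\{\tfrac{b}{p^N}\right\}\right)\qquad(b\in\mathbb{Z},\ N\ge 0),$$ where $\{x\}=x-\lfloor x\rfloor$, $\mathbb{B}_n(X)=\sum_{k=0}^n\binom nk B_{n-k}X^k$ is the $n$-th Bernoulli polynomial and $B_k$ are the Bernoulli numbers ($B_1=-\tfrac12$). For $\alpha\in\mathbb{Z}_p^\times$ put $(\alpha_*\mu)(U):=\mu(\alpha^{-1}U)$.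 The distribution $$\mu_{n,\alpha}:=\mu_n-\alpha^n\cdot\alpha_*\mu_n$$ is bounded; it is the $n$-th regularized Bernoulli measure. For $\rho>1$ let $C^{\mathrm{an}}_\rho(\mathbb{Z}_p,\mathbb{Q}_p)$ be the space of functions $f(t)=\sum_{k\ge0}a_kt^k$ on $\mathbb{Z}_p$ with $a_k\in\mathbb{Q}_p$ and $|a_k|_p\rho^k\to0$, with the norm $\max_k|a_k|_p\rho^k$, and let $C^\dagger(\mathbb{Z}_p,\mathbb{Q}_p):=\varinjlim_{\rho>1}C^{\mathrm{an}}_\rho(\mathbb{Z}_p,\mathbb{Q}_p)$ be the space of overconvergent functions with the inductive limit topology. The $n$-th Bernoulli functional is the continuous $\mathbb{Q}_p$-linear functional $$\mathcal{L}_n\colon C^\dagger(\mathbb{Z}_p,\mathbb{Q}_p)\to\mathbb{Q}_p,\qquad \sum_{k\ge0}a_kt^k\mapsto\sum_{k\ge0}n\cdot a_k\frac{B_{k+n}}{k+n}\quad(n\ge1),$$ and $\mathcal{L}_0:=0$. Put $(\alpha_*\mathcal{L}_n)(f(t)):=\mathcal{L}_n(f(\alpha t))$. **Proposition.** For every integer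 $n\ge0$ and every $\alpha\in\mathbb{Z}_p^\times$, $$\mu_{n,\alpha}=\mathcal{L}_n-\alpha^n\cdot\alpha_*\mathcal{L}_n$$ as continuous $\mathbb{Q}_p$-linear functionals $C^\dagger(\mathbb{Z}_p,\mathbb{Q}_p)\to\mathbb{Q}_p$, where $\mu_{n,\alpha}$ is viewed as a functional by integration. -/

import Mathlib

/-- The residue class `b + p ^ N ℤ_p`, as a compact open subset of `ℤ_p`. -/
def padicResidueClass (p : ℕ) [Fact p.Prime] (N : ℕ) (b : ℤ_[p]) :
    TopologicalSpace.CompactOpens ℤ_[p] where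
  carrier := {x | ∃ y : ℤ_[p], x = b + (p : ℤ_[p]) ^ N * y}
  isCompact' := by
    have : {x | ∃ y : ℤ_[p], x = b + (p : ℤ_[p]) ^ N * y}
        = Set.range (fun y : ℤ_[p] => b + (p : ℤ_[p]) ^ N * y) := by
      ext x; simp [eq_comm]
    rw [this]
    exact isCompact_range (by fun_prop)
  isOpen' := by
    have : {x | ∃ y : ℤ_[p], x = b + (p : ℤ_[p]) ^ N * y}
        = Metric.closedBall b ((p : ℝ) ^ (-N : ℤ)) := by
      ext x
      rw [Metric.mem_closedBall, dist_eq_norm, PadicInt.norm_le_pow_iff_mem_span_pow,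
        Ideal.mem_span_singleton', Set.mem_ofPred_eq]
      exact exists_congr fun y => ⟨fun h => by rw [h]; ring, fun h => by linear_combination -h⟩
    rw [this]
    exact IsUltrametricDist.isOpen_closedBall b
      (zpow_ne_zero _ (Nat.cast_ne_zero.2 (Fact.out : p.Prime).ne_zero))

/-- A `p`-adic distribution on `ℤ_p`: a finitely additive function on the compact open subsets
of `ℤ_p` with values in `ℚ_p`. Additivity for two disjoint sets (which includes the value `0` on
the empty set) is the same as additivity for finitely many pairwise disjoint sets. -/
structure PadicDistribution (p : ℕ) [Fact p.Prime] where
  /-- The value on a compact open subset. -/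
  toFun : TopologicalSpace.CompactOpens ℤ_[p] → ℚ_[p]
  map_sup' : ∀ U V : TopologicalSpace.CompactOpens ℤ_[p], Disjoint U V →
    toFun (U ⊔ V) = toFun U + toFun V

section ResidueClasses

variable {p : ℕ} [Fact p.Prime]

theorem mem_padicResidueClass {N : ℕ} {b x : ℤ_[p]} :
    x ∈ padicResidueClass p N b ↔ (p : ℤ_[p]) ^ N ∣ x - b :=
  exists_congr fun y => ⟨fun h => by rw [h]; ring, fun h => by linear_combination h⟩

theorem padic_exists_natCast_rep (N : ℕ) (x : ℤ_[p]) :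
    ∃ b < p ^ N, (p : ℤ_[p]) ^ N ∣ x - (b : ℤ_[p]) :=
  ⟨x.appr N, x.appr_lt N, Ideal.mem_span_singleton.1 (x.appr_spec N)⟩

theorem padic_natCast_rep_unique {N b c : ℕ} (hb : b < p ^ N) (hc : c < p ^ N)
    (h : (p : ℤ_[p]) ^ N ∣ (b : ℤ_[p]) - c) : b = c := by
  have h1 : (p ^ N : ℤ) ∣ (b : ℤ) - c := by
    rw [← PadicInt.pow_p_dvd_int_iff]; push_cast; exact h
  have h2 : (c : ℤ) ≡ b [ZMOD (p ^ N : ℕ)] := by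
    rw [Int.modEq_iff_dvd]; exact_mod_cast h1
  exact (Nat.ModEq.eq_of_lt_of_lt (Int.natCast_modEq_iff.1 h2) hc hb).symm

/-- A compact open subset is a union of residue classes modulo `p ^ N` for all large `N`. -/
theorem padic_compactOpens_level (U : TopologicalSpace.CompactOpens ℤ_[p]) :
    ∃ N₀ : ℕ, ∀ N ≥ N₀, ∀ x y : ℤ_[p], (p : ℤ_[p]) ^ N ∣ x - y → (x ∈ U ↔ y ∈ U) := by
  obtain ⟨δ, hδ, h⟩ := lebesgue_number_lemma_of_metric_sUnion (s := (U : Set ℤ_[p]))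
    (c := {(U : Set ℤ_[p])}) U.isCompact (by simpa using U.isOpen) (by simp)
  simp only [Set.mem_singleton_iff, exists_eq_left] at h
  obtain ⟨N₀, hN₀⟩ := exists_pow_lt_of_lt_one hδ (inv_lt_one_of_one_lt₀
    (Nat.one_lt_cast.2 (Fact.out : p.Prime).one_lt) : (p : ℝ)⁻¹ < 1)
  have key : ∀ N ≥ N₀, ∀ x y : ℤ_[p], (p : ℤ_[p]) ^ N ∣ x - y → x ∈ U → y ∈ U := by
    intro N hN x y hxy hx
    refine h x hx ?_
    rw [Metric.mem_ball, dist_comm, dist_eq_norm]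
    refine lt_of_le_of_lt ?_ hN₀
    have := (PadicInt.norm_le_pow_iff_mem_span_pow (x - y) N₀).2
      (Ideal.mem_span_singleton.2 ((pow_dvd_pow _ hN).trans hxy))
    simpa [zpow_neg] using this
  exact ⟨N₀, fun N hN x y hxy => ⟨key N hN x y hxy, key N hN y x ((dvd_sub_comm).1 hxy)⟩⟩

theorem padic_sum_range_pow_succ {M : Type*} [AddCommMonoid M] (p N : ℕ) [Fact p.Prime]
    (g : ℕ → M) :
    ∑ c ∈ Finset.range (p ^ (N + 1)), g c
      = ∑ b ∈ Finset.range (p ^ N), ∑ i ∈ Finset.range p, g (b + p ^ N * i) := by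
  have hp : 0 < p ^ N := pow_pos (Fact.out : p.Prime).pos N
  rw [← Finset.sum_product', eq_comm]
  refine Finset.sum_nbij' (fun x => x.1 + p ^ N * x.2) (fun c => (c % p ^ N, c / p ^ N))
    ?_ ?_ ?_ ?_ ?_
  · rintro ⟨b, i⟩ h
    simp only [Finset.mem_product, Finset.mem_range] at h ⊢
    calc b + p ^ N * i < p ^ N * (i + 1) := by rw [mul_add]; linarith [h.1]
      _ ≤ p ^ N * p := Nat.mul_le_mul_left _ h.2
      _ = p ^ (N + 1) := (pow_succ _ _).symm
  · intro c h
    simp only [Finset.mem_product, Finset.mem_range] at h ⊢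
    exact ⟨Nat.mod_lt _ hp, Nat.div_lt_of_lt_mul (by rwa [← pow_succ])⟩
  · rintro ⟨b, i⟩ h
    simp only [Finset.mem_product, Finset.mem_range] at h ⊢
    ext
    · simp [Nat.mod_eq_of_lt h.1]
    · simp [Nat.add_mul_div_left _ _ hp, Nat.div_eq_of_lt h.1]
  · intro c _
    exact Nat.mod_add_div c (p ^ N)
  · intros; rfl

theorem disjoint_padicResidueClass {N b c : ℕ} (hb : b < p ^ N) (hc : c < p ^ N) (h : b ≠ c) :
    Disjoint (padicResidueClass p N b) (padicResidueClass p N c) := by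
  rw [disjoint_iff]
  refine TopologicalSpace.CompactOpens.ext ?_
  rw [TopologicalSpace.CompactOpens.coe_inf, TopologicalSpace.CompactOpens.coe_bot,
    Set.eq_empty_iff_forall_notMem]
  rintro x ⟨h1, h2⟩
  refine h (padic_natCast_rep_unique hb hc ?_)
  have h1' := mem_padicResidueClass.1 h1
  have h2' := mem_padicResidueClass.1 h2
  simpa using dvd_sub h2' h1'

open Classical in
theorem padicResidueClass_sup_eq {U : TopologicalSpace.CompactOpens ℤ_[p]} {N : ℕ}
    (hU : ∀ x y : ℤ_[p], (p : ℤ_[p]) ^ N ∣ x - y → (x ∈ U ↔ y ∈ U)) :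
    ((Finset.range (p ^ N)).filter fun b : ℕ => (b : ℤ_[p]) ∈ U).sup
      (fun b : ℕ => padicResidueClass p N b) = U := by
  refine TopologicalSpace.CompactOpens.ext ?_
  ext x
  rw [TopologicalSpace.CompactOpens.coe_finsetSup]
  simp only [Set.mem_iUnion, Finset.mem_filter, Finset.mem_range, SetLike.mem_coe,
    mem_padicResidueClass, exists_prop]
  constructor
  · rintro ⟨b, ⟨_, hb⟩, hx⟩
    exact (hU _ _ hx).2 hb
  · intro hx
    obtain ⟨b, hb, h⟩ := padic_exists_natCast_rep N x
    exact ⟨b, ⟨hb, (hU _ _ h).1 hx⟩, h⟩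

end ResidueClasses

namespace PadicDistribution

variable {p : ℕ} [Fact p.Prime]

instance : CoeFun (PadicDistribution p) fun _ => TopologicalSpace.CompactOpens ℤ_[p] → ℚ_[p] :=
  ⟨toFun⟩

theorem map_bot (μ : PadicDistribution p) : μ ⊥ = 0 := by
  have := μ.map_sup' ⊥ ⊥ disjoint_bot_left
  simpa using this

theorem map_finset_sup (μ : PadicDistribution p) {ι : Type*} (s : Finset ι)
    (U : ι → TopologicalSpace.CompactOpens ℤ_[p])
    (h : (s : Set ι).PairwiseDisjoint U) : μ (s.sup U) = ∑ i ∈ s, μ (U i) := by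
  classical
  induction s using Finset.induction_on with
  | empty => simpa using μ.map_bot
  | insert a s ha ih =>
    rw [Finset.coe_insert] at h
    rw [Finset.sup_insert, Finset.sum_insert ha, μ.map_sup' _ _ ?_,
      ih (h.subset (Set.subset_insert _ _))]
    rw [Finset.disjoint_sup_right]
    intro i hi
    exact h (Set.mem_insert _ _) (Set.mem_insert_of_mem _ hi) (fun e => ha (e ▸ hi))

open Classical in
theorem apply_eq_sum (μ : PadicDistribution p) {U : TopologicalSpace.CompactOpens ℤ_[p]} {N : ℕ}
    (hU : ∀ x y : ℤ_[p], (p : ℤ_[p]) ^ N ∣ x - y → (x ∈ U ↔ y ∈ U)) :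
    μ U = ∑ b ∈ (Finset.range (p ^ N)).filter (fun b : ℕ => (b : ℤ_[p]) ∈ U),
      μ (padicResidueClass p N b) := by
  conv_lhs => rw [← padicResidueClass_sup_eq hU]
  refine μ.map_finset_sup _ _ ?_
  intro b hb c hc hbc
  simp only [Finset.coe_filter, Finset.mem_range, Set.mem_ofPred_eq] at hb hc
  exact disjoint_padicResidueClass hb.1 hc.1 hbc

theorem ext_of_residueClass {μ ν : PadicDistribution p}
    (h : ∀ (N b : ℕ), b < p ^ N → μ (padicResidueClass p N b) = ν (padicResidueClass p N b)) :
    μ = ν := by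
  have : μ.toFun = ν.toFun := by
    funext U
    obtain ⟨N, hN⟩ := padic_compactOpens_level U
    rw [μ.apply_eq_sum (hN N le_rfl), ν.apply_eq_sum (hN N le_rfl)]
    refine Finset.sum_congr rfl fun b hb => h N b ?_
    simp only [Finset.mem_filter, Finset.mem_range] at hb
    exact hb.1
  cases μ; cases ν; simpa using this

/-- A bound on the residue classes is a bound on all compact open subsets. -/
theorem bounded_of_residueClass {μ : PadicDistribution p} {C : ℝ} (hC : 0 ≤ C)
    (h : ∀ (N b : ℕ), b < p ^ N → ‖μ (padicResidueClass p N b)‖ ≤ C)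
    (U : TopologicalSpace.CompactOpens ℤ_[p]) : ‖μ U‖ ≤ C := by
  obtain ⟨N, hN⟩ := padic_compactOpens_level U
  rw [μ.apply_eq_sum (hN N le_rfl)]
  refine IsUltrametricDist.norm_sum_le_of_forall_le_of_nonneg hC fun b hb => h N b ?_
  simp only [Finset.mem_filter, Finset.mem_range] at hb
  exact hb.1

/-- The value on `b + p ^ N ℤ_p` is the sum of the values on its subclasses modulo `p ^ (N + 1)`. -/
theorem apply_residueClass_eq_sum (μ : PadicDistribution p) (N b : ℕ) (hb : b < p ^ N) :
    μ (padicResidueClass p N b)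
      = ∑ i ∈ Finset.range p, μ (padicResidueClass p (N + 1) ((b + p ^ N * i : ℕ) : ℤ_[p])) := by
  classical
  rw [μ.apply_eq_sum (U := padicResidueClass p N b) (N := N + 1), Finset.sum_filter,
    padic_sum_range_pow_succ, Finset.sum_eq_single_of_mem b (Finset.mem_range.2 hb)]
  · refine Finset.sum_congr rfl fun i _ => if_pos ?_
    rw [mem_padicResidueClass]
    exact ⟨i, by push_cast; ring⟩
  · intro c hc hcb
    refine Finset.sum_eq_zero fun i _ => if_neg fun h => hcb ?_
    rw [mem_padicResidueClass] at h
    refine padic_natCast_rep_unique (Finset.mem_range.1 hc) hb ?_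
    have := dvd_sub h (Dvd.intro (i : ℤ_[p]) rfl : (p : ℤ_[p]) ^ N ∣ _)
    convert this using 1
    push_cast; ring
  · intro x y hxy
    rw [mem_padicResidueClass, mem_padicResidueClass]
    have h' := (pow_dvd_pow (p : ℤ_[p]) N.le_succ).trans hxy
    rw [← dvd_add_right (b := x - y) (c := y - b) h']
    ring_nf

end PadicDistribution

section BernoulliDistribution

/-- The distribution relation of the Bernoulli polynomials. -/
theorem bernoulli_multiplication (m : ℕ) (hm : m ≠ 0) (n : ℕ) (x : ℚ) :
    (m : ℚ) ^ ((n : ℤ) - 1) * ∑ i ∈ Finset.range m,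
      (Polynomial.bernoulli n).eval ((x + i) / m) = (Polynomial.bernoulli n).eval x := by
  have hm' : (m : ℚ) ≠ 0 := Nat.cast_ne_zero.2 hm
  -- `Q k` is the left-hand side as a polynomial.
  set Q : ℕ → Polynomial ℚ := fun k => Polynomial.C ((m : ℚ) ^ ((k : ℤ) - 1)) *
    ∑ i ∈ Finset.range m, (Polynomial.bernoulli k).comp
      (Polynomial.C ((m : ℚ)⁻¹) * (Polynomial.X + Polynomial.C (i : ℚ))) with hQ
  have hQeval : ∀ k y, (Q k).eval y = (m : ℚ) ^ ((k : ℤ) - 1) * ∑ i ∈ Finset.range m,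
      (Polynomial.bernoulli k).eval ((y + i) / m) := by
    intro k y
    simp only [hQ, Polynomial.eval_mul, Polynomial.eval_C, Polynomial.eval_finsetSum,
      Polynomial.eval_comp, Polynomial.eval_add, Polynomial.eval_X]
    congr 1
    exact Finset.sum_congr rfl fun i _ => by rw [div_eq_inv_mul]
  have hQd : ∀ k, Polynomial.derivative (Q (k + 1)) = Polynomial.C ((k : ℚ) + 1) * Q k := by
    intro k
    simp only [hQ, Polynomial.derivative_mul, Polynomial.derivative_C, zero_mul, zero_add,
      Polynomial.derivative_sum, Polynomial.derivative_comp, Polynomial.derivative_add,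
      Polynomial.derivative_X, add_zero, mul_one, Polynomial.derivative_bernoulli_add_one]
    have e : (m : ℚ) ^ (((k + 1 : ℕ) : ℤ) - 1) = m * (m : ℚ) ^ ((k : ℤ) - 1) := by
      rw [← zpow_one_add₀ hm']; congr 1; push_cast; ring
    rw [e, Finset.mul_sum, Finset.mul_sum, Finset.mul_sum]
    refine Finset.sum_congr rfl fun i _ => ?_
    have h1 : Polynomial.C (m : ℚ) * Polynomial.C ((m : ℚ)⁻¹) = 1 := by
      rw [← Polynomial.C_mul, mul_inv_cancel₀ hm', Polynomial.C_1]
    simp only [Polynomial.mul_comp, Polynomial.add_comp, Polynomial.natCast_comp,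
      Polynomial.one_comp, Polynomial.C_mul, Polynomial.C_add, Polynomial.C_1, map_natCast] at h1 ⊢
    linear_combination (Polynomial.C ((m : ℚ) ^ ((k : ℤ) - 1)) * ((k : Polynomial ℚ) + 1) *
      (Polynomial.bernoulli k).comp
        (Polynomial.C ((m : ℚ)⁻¹) * (Polynomial.X + (i : Polynomial ℚ)))) * h1
  have hQdiff : ∀ k, (Q (k + 1)).eval 1 - (Q (k + 1)).eval 0
      = (Polynomial.bernoulli (k + 1)).eval 1 - (Polynomial.bernoulli (k + 1)).eval 0 := by
    intro k
    have tel : ∑ i ∈ Finset.range m, (Polynomial.bernoulli (k + 1)).eval ((1 + (i : ℚ)) / m)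
        - ∑ i ∈ Finset.range m, (Polynomial.bernoulli (k + 1)).eval ((0 + (i : ℚ)) / m)
        = (Polynomial.bernoulli (k + 1)).eval 1 - (Polynomial.bernoulli (k + 1)).eval 0 := by
      have := Finset.sum_range_sub
        (fun i : ℕ => (Polynomial.bernoulli (k + 1)).eval ((i : ℚ) / m)) m
      rw [div_self hm', Nat.cast_zero, zero_div, Finset.sum_sub_distrib] at this
      rw [← this]
      congr 1
      · exact Finset.sum_congr rfl fun i _ => by push_cast; rw [add_comm]
      · exact Finset.sum_congr rfl fun i _ => by rw [zero_add]
    have h01 : (Polynomial.bernoulli (k + 1)).eval 1 - (Polynomial.bernoulli (k + 1)).eval 0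
        = (k + 1) * 0 ^ k := by
      have := Polynomial.bernoulli_eval_one_add (k + 1) 0
      rw [add_zero] at this
      rw [this]; push_cast; simp
    rw [hQeval, hQeval, ← mul_sub, tel, h01]
    rcases Nat.eq_zero_or_pos k with rfl | hk
    · simp
    · simp [hk.ne']
  have hder : ∀ P : Polynomial ℚ, Polynomial.derivative P = 0 → ∃ c, P = Polynomial.C c :=
    fun P hP => ⟨_, Polynomial.eq_C_of_derivative_eq_zero hP⟩
  -- First up to a constant, which vanishes by comparing increments one degree higher.
  have step : ∀ (k : ℕ) (c : ℚ), Q k = Polynomial.bernoulli k + Polynomial.C c → c = 0 := by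
    intro k c hc
    obtain ⟨d, hd⟩ := hder (Q (k + 1) - Polynomial.bernoulli (k + 1)
        - Polynomial.C (((k : ℚ) + 1) * c) * Polynomial.X) (by
      rw [Polynomial.derivative_sub, Polynomial.derivative_sub, hQd, hc,
        Polynomial.derivative_bernoulli_add_one, Polynomial.derivative_C_mul,
        Polynomial.derivative_X]
      simp only [Polynomial.C_mul, Polynomial.C_add, Polynomial.C_1, map_natCast]
      ring)
    have e1 := congrArg (Polynomial.eval 1) hd
    have e0 := congrArg (Polynomial.eval 0) hd
    simp only [Polynomial.eval_sub, Polynomial.eval_mul, Polynomial.eval_C,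
      Polynomial.eval_X] at e1 e0
    have h := hQdiff k
    have : ((k : ℚ) + 1) * c = 0 := by linarith
    rcases mul_eq_zero.1 this with h0 | h0
    · exact absurd h0 (by positivity)
    · exact h0
  have conclude : ∀ k, (∃ c, Q k = Polynomial.bernoulli k + Polynomial.C c) →
      Q k = Polynomial.bernoulli k := by
    rintro k ⟨c, hc⟩
    rw [hc, step k c hc]; simp
  have main : ∀ k, Q k = Polynomial.bernoulli k := by
    intro k
    induction k with
    | zero =>
      apply conclude 0
      refine ⟨0, ?_⟩
      simp only [hQ, Polynomial.bernoulli_zero, Polynomial.one_comp]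
      simp only [Finset.sum_const, Finset.card_range, nsmul_eq_mul, mul_one, map_zero, add_zero]
      rw [← map_natCast Polynomial.C, ← Polynomial.C_mul, ← Polynomial.C_1]
      congr 1
      simp [hm']
    | succ k ih =>
      apply conclude (k + 1)
      obtain ⟨c, hc⟩ := hder (Q (k + 1) - Polynomial.bernoulli (k + 1)) (by
        rw [Polynomial.derivative_sub, hQd, ih, Polynomial.derivative_bernoulli_add_one]
        simp)
      exact ⟨c, by rw [← hc]; ring⟩
  rw [← hQeval, main]


theorem exists_padicDistribution_of_compatible (p : ℕ) [Fact p.Prime] (v : ℕ → ℕ → ℚ_[p])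
    (hv : ∀ N b, b < p ^ N → v N b = ∑ i ∈ Finset.range p, v (N + 1) (b + p ^ N * i)) :
    ∃ μ : PadicDistribution p, ∀ N b, b < p ^ N → μ (padicResidueClass p N b) = v N b := by
  classical
  set S : ℕ → TopologicalSpace.CompactOpens ℤ_[p] → ℚ_[p] := fun N U =>
    ∑ b ∈ Finset.range (p ^ N), if (b : ℤ_[p]) ∈ U then v N b else 0 with hS
  have hconst : ∀ (U : TopologicalSpace.CompactOpens ℤ_[p]) (N₀ : ℕ),
      (∀ N ≥ N₀, ∀ x y : ℤ_[p], (p : ℤ_[p]) ^ N ∣ x - y → (x ∈ U ↔ y ∈ U)) →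
      ∀ N ≥ N₀, S N U = S N₀ U := by
    intro U N₀ h N hN
    induction N, hN using Nat.le_induction with
    | base => rfl
    | succ N hN ih =>
      rw [← ih]
      simp only [hS]
      rw [padic_sum_range_pow_succ]
      refine Finset.sum_congr rfl fun b hb => ?_
      have hi : ∀ i : ℕ, ((b + p ^ N * i : ℕ) : ℤ_[p]) ∈ U ↔ (b : ℤ_[p]) ∈ U := fun i =>
        h N hN _ _ ⟨i, by push_cast; ring⟩
      simp only [hi]
      split_ifs with hbU
      · exact (hv N b (Finset.mem_range.1 hb)).symm
      · simp
  have hex : ∀ U, ∃ w, ∃ N₀, ∀ N ≥ N₀, S N U = w := fun U => by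
    obtain ⟨N₀, h⟩ := padic_compactOpens_level U
    exact ⟨_, N₀, hconst U N₀ h⟩
  choose μ hμ using hex
  refine ⟨⟨μ, fun U V hUV => ?_⟩, fun N b hb => ?_⟩
  · obtain ⟨N₁, h₁⟩ := hμ U
    obtain ⟨N₂, h₂⟩ := hμ V
    obtain ⟨N₃, h₃⟩ := hμ (U ⊔ V)
    set N := max N₁ (max N₂ N₃)
    rw [← h₁ N (by omega), ← h₂ N (by omega), ← h₃ N (by omega)]
    simp only [hS]
    rw [← Finset.sum_add_distrib]
    refine Finset.sum_congr rfl fun b _ => ?_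
    have hd : (b : ℤ_[p]) ∈ U → (b : ℤ_[p]) ∈ V → False := fun hu hw => by
      have hbot := congrArg (fun W : TopologicalSpace.CompactOpens ℤ_[p] => (W : Set ℤ_[p]))
        (disjoint_iff.1 hUV)
      simp only [TopologicalSpace.CompactOpens.coe_inf,
        TopologicalSpace.CompactOpens.coe_bot] at hbot
      exact (Set.eq_empty_iff_forall_notMem.1 hbot) _ ⟨hu, hw⟩
    have hm : (b : ℤ_[p]) ∈ U ⊔ V ↔ (b : ℤ_[p]) ∈ U ∨ (b : ℤ_[p]) ∈ V := Iff.rfl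
    by_cases hu : (b : ℤ_[p]) ∈ U
    · have hw : (b : ℤ_[p]) ∉ V := fun hw => hd hu hw
      simp [hm, hu, hw]
    · simp [hm, hu]
  · obtain ⟨N₁, h₁⟩ := hμ (padicResidueClass p N b)
    show μ (padicResidueClass p N b) = v N b
    have hlev : ∀ M ≥ N, ∀ x y : ℤ_[p], (p : ℤ_[p]) ^ M ∣ x - y →
        (x ∈ padicResidueClass p N b ↔ y ∈ padicResidueClass p N b) := by
      intro M hM x y hxy
      rw [mem_padicResidueClass, mem_padicResidueClass]
      have h' := (pow_dvd_pow (p : ℤ_[p]) hM).trans hxy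
      rw [← dvd_add_right (b := x - y) (c := y - b) h']
      ring_nf
    rw [← h₁ (max N N₁) (le_max_right _ _), hconst _ N hlev _ (le_max_left _ _)]
    simp only [hS]
    rw [Finset.sum_eq_single_of_mem b (Finset.mem_range.2 hb)]
    · exact if_pos (mem_padicResidueClass.2 (by simp))
    · intro c hc hcb
      exact if_neg fun h => hcb (padic_natCast_rep_unique (Finset.mem_range.1 hc) hb
        (mem_padicResidueClass.1 h))

theorem padicResidueClass_congr {p : ℕ} [Fact p.Prime] {N : ℕ} {b c : ℤ_[p]}
    (h : (p : ℤ_[p]) ^ N ∣ b - c) : padicResidueClass p N b = padicResidueClass p N c := by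
  refine TopologicalSpace.CompactOpens.ext ?_
  ext x
  rw [SetLike.mem_coe, SetLike.mem_coe, mem_padicResidueClass, mem_padicResidueClass,
    ← dvd_add_left (a := (p : ℤ_[p]) ^ N) (b := x - b) (c := b - c) h]
  ring_nf

theorem existsUnique_bernoulliDistribution (p : ℕ) [Fact p.Prime] (n : ℕ) :
    ∃! μ : PadicDistribution p, ∀ (b : ℤ) (N : ℕ), μ (padicResidueClass p N b) =
      (((p : ℚ) ^ ((N : ℤ) * ((n : ℤ) - 1)) *
        (Polynomial.bernoulli n).eval (Int.fract ((b : ℚ) / (p : ℚ) ^ N)) : ℚ) : ℚ_[p]) := by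
  have hp0 : p ≠ 0 := (Fact.out : p.Prime).ne_zero
  have hp : (p : ℚ) ≠ 0 := Nat.cast_ne_zero.2 hp0
  obtain ⟨μ, hμ⟩ := exists_padicDistribution_of_compatible p
    (fun N b => (((p : ℚ) ^ ((N : ℤ) * ((n : ℤ) - 1)) *
        (Polynomial.bernoulli n).eval ((b : ℚ) / (p : ℚ) ^ N) : ℚ) : ℚ_[p])) (by
    intro N b _
    rw [← Rat.cast_sum]
    congr 1
    rw [← bernoulli_multiplication p hp0 n ((b : ℚ) / (p : ℚ) ^ N), ← mul_assoc,
      ← Finset.mul_sum, ← zpow_add₀ hp]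
    congr 1
    · congr 1; push_cast; ring
    · refine Finset.sum_congr rfl fun i _ => ?_
      congr 1
      push_cast
      field_simp
      ring)
  refine ⟨μ, fun b N => ?_, fun ν hν => ?_⟩
  · have hpN : (0 : ℤ) < (p : ℤ) ^ N := by positivity
    have hc0 := Int.emod_nonneg b hpN.ne'
    have hc1 := Int.emod_lt_of_pos b hpN
    obtain ⟨c, hc⟩ := Int.eq_ofNat_of_zero_le hc0
    have hcN : c < p ^ N := by rw [hc] at hc1; exact_mod_cast hc1
    have hb : b = c + (p : ℤ) ^ N * (b / (p : ℤ) ^ N) := by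
      rw [← hc]; exact (Int.emod_add_mul_ediv _ _).symm
    have hcong : padicResidueClass p N (b : ℤ_[p]) = padicResidueClass p N (c : ℤ_[p]) := by
      apply padicResidueClass_congr
      refine ⟨((b / (p : ℤ) ^ N : ℤ) : ℤ_[p]), ?_⟩
      conv_lhs => rw [hb]
      push_cast; ring
    have hfr : Int.fract ((b : ℚ) / (p : ℚ) ^ N) = (c : ℚ) / (p : ℚ) ^ N := by
      rw [Int.fract_eq_iff]
      refine ⟨by positivity, ?_, b / (p : ℤ) ^ N, ?_⟩
      · rw [div_lt_one (by positivity)]; exact_mod_cast hcN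
      · have hbq : (b : ℚ) = c + (p : ℚ) ^ N * ((b / (p : ℤ) ^ N : ℤ) : ℚ) := by
          exact_mod_cast congrArg (Int.cast : ℤ → ℚ) hb
        rw [← sub_div, div_eq_iff (by positivity)]
        linear_combination hbq
    rw [hcong, hμ N c hcN, hfr]
  · refine PadicDistribution.ext_of_residueClass fun N b hb => ?_
    have h := hν (b : ℤ) N
    have hfr : Int.fract ((b : ℚ) / (p : ℚ) ^ N) = (b : ℚ) / (p : ℚ) ^ N := by
      rw [Int.fract_eq_self]
      refine ⟨by positivity, ?_⟩
      rw [div_lt_one (by positivity)]; exact_mod_cast hb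
    rw [Int.cast_natCast, Int.cast_natCast, hfr] at h
    rw [h, hμ N b hb]

/-- The `n`-th Bernoulli distribution `μ_n`: the unique `p`-adic distribution with
`μ_n (b + p ^ N ℤ_p) = p ^ (N (n - 1)) B_n({b / p ^ N})` for all `b ∈ ℤ` and `N ≥ 0`. -/
noncomputable def bernoulliDistribution (p : ℕ) [Fact p.Prime] (n : ℕ) : PadicDistribution p :=
  (existsUnique_bernoulliDistribution p n).choose

theorem bernoulliDistribution_apply (p : ℕ) [Fact p.Prime] (n : ℕ) (b : ℤ) (N : ℕ) :
    bernoulliDistribution p n (padicResidueClass p N b) =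
      (((p : ℚ) ^ ((N : ℤ) * ((n : ℤ) - 1)) *
        (Polynomial.bernoulli n).eval (Int.fract ((b : ℚ) / (p : ℚ) ^ N)) : ℚ) : ℚ_[p]) :=
  (existsUnique_bernoulliDistribution p n).choose_spec.1 b N

end BernoulliDistribution

namespace PadicDistribution

variable {p : ℕ} [Fact p.Prime]

noncomputable instance : Sub (PadicDistribution p) :=
  ⟨fun μ ν => ⟨fun U => μ U - ν U, fun U V h => by
    rw [μ.map_sup' U V h, ν.map_sup' U V h]; ring⟩⟩

noncomputable instance : SMul ℚ_[p] (PadicDistribution p) :=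
  ⟨fun c μ => ⟨fun U => c * μ U, fun U V h => by rw [μ.map_sup' U V h]; ring⟩⟩

/-- The image `α⁻¹ U` of a compact open subset under multiplication by the inverse of a unit. -/
noncomputable def unitInvMul (α : ℤ_[p]ˣ) (U : TopologicalSpace.CompactOpens ℤ_[p]) :
    TopologicalSpace.CompactOpens ℤ_[p] :=
  U.map (fun x => ((α⁻¹ : ℤ_[p]ˣ) : ℤ_[p]) * x) (by fun_prop)
    (by simpa only [Units.smul_def, smul_eq_mul] using isOpenMap_smul (α⁻¹ : ℤ_[p]ˣ) (α := ℤ_[p]))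

theorem coe_unitInvMul (α : ℤ_[p]ˣ) (U : TopologicalSpace.CompactOpens ℤ_[p]) :
    (unitInvMul α U : Set ℤ_[p]) = (fun x => ((α⁻¹ : ℤ_[p]ˣ) : ℤ_[p]) * x) '' U := rfl

/-- The push-forward `α_* μ` of a distribution under multiplication by a unit `α`:
`(α_* μ) U = μ (α⁻¹ U)`. -/
noncomputable def pushforward (α : ℤ_[p]ˣ) (μ : PadicDistribution p) : PadicDistribution p where
  toFun U := μ (unitInvMul α U)
  map_sup' U V h := by
    rw [← μ.map_sup']
    · congr 1
      exact TopologicalSpace.CompactOpens.ext (Set.image_union _ _ _)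
    · rw [disjoint_iff] at h ⊢
      refine TopologicalSpace.CompactOpens.ext ?_
      have h' := congrArg (fun W : TopologicalSpace.CompactOpens ℤ_[p] => (W : Set ℤ_[p])) h
      simp only [TopologicalSpace.CompactOpens.coe_inf,
        TopologicalSpace.CompactOpens.coe_bot] at h' ⊢
      rw [coe_unitInvMul, coe_unitInvMul,
        ← Set.image_inter (Units.isUnit (α⁻¹)).mul_right_injective, h', Set.image_empty]

end PadicDistribution

/-- The distribution `μ_{n,α} = μ_n - α ^ n • α_* μ_n`. -/
noncomputable def regularizedBernoulliDistribution (p : ℕ) [Fact p.Prime] (n : ℕ) (α : ℤ_[p]ˣ) :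
    PadicDistribution p :=
  bernoulliDistribution p n -
    ((α : ℤ_[p]) : ℚ_[p]) ^ n • (bernoulliDistribution p n).pushforward α

theorem regularizedBernoulliDistribution_bounded (p : ℕ) [Fact p.Prime] (n : ℕ) (α : ℤ_[p]ˣ) :
    ∃ C : ℝ, ∀ U, ‖regularizedBernoulliDistribution p n α U‖ ≤ C := by
  have hp0 : p ≠ 0 := (Fact.out : p.Prime).ne_zero
  have hpQ : (p : ℚ_[p]) ≠ 0 := Nat.cast_ne_zero.2 hp0
  set B : ℕ → ℚ_[p] := fun i => ((bernoulli i * (n.choose i : ℚ) : ℚ) : ℚ_[p]) with hB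
  have hval : ∀ N b : ℕ, b < p ^ N → bernoulliDistribution p n (padicResidueClass p N b)
      = ∑ i ∈ Finset.range (n + 1), B i * (p : ℚ_[p]) ^ ((N : ℤ) * ((i : ℤ) - 1))
          * (b : ℚ_[p]) ^ (n - i) := by
    intro N b hb
    have h := bernoulliDistribution_apply p n (b : ℤ) N
    have hfr : Int.fract ((b : ℚ) / (p : ℚ) ^ N) = (b : ℚ) / (p : ℚ) ^ N := by
      rw [Int.fract_eq_self]
      refine ⟨by positivity, ?_⟩
      rw [div_lt_one (by positivity)]; exact_mod_cast hb
    rw [Int.cast_natCast, Int.cast_natCast, hfr] at h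
    rw [h, Polynomial.bernoulli, Polynomial.eval_finsetSum, Finset.mul_sum, Rat.cast_sum]
    refine Finset.sum_congr rfl fun i hi => ?_
    have hin : i ≤ n := Nat.lt_succ_iff.1 (Finset.mem_range.1 hi)
    rw [Polynomial.eval_monomial, hB]
    push_cast
    have e : (p : ℚ_[p]) ^ ((N : ℤ) * ((n : ℤ) - 1))
        = (p : ℚ_[p]) ^ ((N : ℤ) * ((i : ℤ) - 1)) * ((p : ℚ_[p]) ^ N) ^ (n - i) := by
      rw [← pow_mul, ← zpow_natCast, ← zpow_add₀ hpQ]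
      congr 1
      push_cast [Nat.cast_sub hin]; ring
    rw [e, div_pow]
    field_simp
  set C : ℝ := ∑ i ∈ Finset.range (n + 1), ‖B i‖ with hC
  refine ⟨C, PadicDistribution.bounded_of_residueClass
    (Finset.sum_nonneg fun _ _ => norm_nonneg _) fun N b hb => ?_⟩
  obtain ⟨c, hc, hbc⟩ := padic_exists_natCast_rep N (((α⁻¹ : ℤ_[p]ˣ) : ℤ_[p]) * (b : ℤ_[p]))
  have himg : PadicDistribution.unitInvMul α (padicResidueClass p N b)
      = padicResidueClass p N (c : ℤ_[p]) := by
    rw [← padicResidueClass_congr hbc]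
    refine TopologicalSpace.CompactOpens.ext ?_
    rw [PadicDistribution.coe_unitInvMul]
    ext x
    rw [Set.mem_image]
    simp only [SetLike.mem_coe, mem_padicResidueClass]
    constructor
    · rintro ⟨y, hy, rfl⟩
      rw [← mul_sub]; exact hy.mul_left _
    · intro hx
      refine ⟨(α : ℤ_[p]) * x, ?_, by simp⟩
      have := hx.mul_left (α : ℤ_[p])
      rwa [mul_sub, Units.mul_inv_cancel_left] at this
  have hdiff : (p : ℤ_[p]) ^ N ∣ (b : ℤ_[p]) - (α : ℤ_[p]) * (c : ℤ_[p]) := by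
    have := hbc.mul_left (α : ℤ_[p])
    rwa [mul_sub, Units.mul_inv_cancel_left] at this
  have hmain : regularizedBernoulliDistribution p n α (padicResidueClass p N b)
      = ∑ i ∈ Finset.range (n + 1), B i * ((p : ℚ_[p]) ^ ((N : ℤ) * ((i : ℤ) - 1))
          * ((b : ℚ_[p]) ^ (n - i) - ((α : ℤ_[p]) : ℚ_[p]) ^ n * (c : ℚ_[p]) ^ (n - i))) := by
    show bernoulliDistribution p n (padicResidueClass p N b) - ((α : ℤ_[p]) : ℚ_[p]) ^ n *
      bernoulliDistribution p n (PadicDistribution.unitInvMul α (padicResidueClass p N b)) = _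
    rw [himg, hval N b hb, hval N c hc, Finset.mul_sum, ← Finset.sum_sub_distrib]
    exact Finset.sum_congr rfl fun i _ => by ring
  rw [hmain]
  refine (norm_sum_le _ _).trans (Finset.sum_le_sum fun i _ => ?_)
  rw [norm_mul]
  refine mul_le_of_le_one_right (norm_nonneg _) ?_
  rcases Nat.eq_zero_or_pos i with rfl | hi
  · obtain ⟨y, hy⟩ := hdiff.trans
      (sub_dvd_pow_sub_pow (b : ℤ_[p]) ((α : ℤ_[p]) * (c : ℤ_[p])) n)
    have hy' : (b : ℚ_[p]) ^ n - ((α : ℤ_[p]) : ℚ_[p]) ^ n * (c : ℚ_[p]) ^ n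
        = (p : ℚ_[p]) ^ N * (y : ℚ_[p]) := by
      have := congrArg (Subtype.val : ℤ_[p] → ℚ_[p]) hy
      push_cast at this
      rw [← this, mul_pow]
    rw [Nat.sub_zero, hy', ← mul_assoc]
    have : (p : ℚ_[p]) ^ ((N : ℤ) * (((0 : ℕ) : ℤ) - 1)) * (p : ℚ_[p]) ^ N = 1 := by
      rw [← zpow_natCast, ← zpow_add₀ hpQ]; simp
    rw [this, one_mul]
    exact y.norm_le_one
  · obtain ⟨j, rfl⟩ : ∃ j, i = j + 1 := ⟨i - 1, by omega⟩
    have e : (p : ℚ_[p]) ^ ((N : ℤ) * (((j + 1 : ℕ) : ℤ) - 1)) * ((b : ℚ_[p]) ^ (n - (j + 1)) -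
        ((α : ℤ_[p]) : ℚ_[p]) ^ n * (c : ℚ_[p]) ^ (n - (j + 1)))
        = (((p : ℤ_[p]) ^ (N * j) * ((b : ℤ_[p]) ^ (n - (j + 1)) -
          (α : ℤ_[p]) ^ n * (c : ℤ_[p]) ^ (n - (j + 1))) : ℤ_[p]) : ℚ_[p]) := by
      push_cast
      congr 1
      rw [← zpow_natCast]
      congr 1
      push_cast; ring
    rw [e]
    exact PadicInt.norm_le_one _

/-- A `p`-adic measure on `ℤ_p`: a bounded `p`-adic distribution. -/
structure PadicMeasure (p : ℕ) [Fact p.Prime] extends PadicDistribution p where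
  bounded' : ∃ C : ℝ, ∀ U, ‖toFun U‖ ≤ C

/-- The `n`-th regularized Bernoulli measure `μ_{n,α} = μ_n - α ^ n • α_* μ_n`. -/
noncomputable def regularizedBernoulliMeasure (p : ℕ) [Fact p.Prime] (n : ℕ) (α : ℤ_[p]ˣ) :
    PadicMeasure p :=
  ⟨regularizedBernoulliDistribution p n α, regularizedBernoulliDistribution_bounded p n α⟩

namespace PadicMeasure

variable {p : ℕ} [Fact p.Prime]

/-- The Riemann sum `∑_{0 ≤ b < p ^ N} f b * μ (b + p ^ N ℤ_p)`. -/
noncomputable def riemannSum (μ : PadicMeasure p) (f : C(ℤ_[p], ℚ_[p])) (N : ℕ) : ℚ_[p] :=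
  ∑ b ∈ Finset.range (p ^ N), f (b : ℤ_[p]) * μ.toFun (padicResidueClass p N b)

theorem riemannSum_tendsto (μ : PadicMeasure p) (f : C(ℤ_[p], ℚ_[p])) :
    ∃ l, Filter.Tendsto (μ.riemannSum f) Filter.atTop (nhds l) := by
  obtain ⟨C, hC⟩ := μ.bounded'
  have hC0 : 0 ≤ C := (norm_nonneg _).trans (hC ⊥)
  refine cauchySeq_tendsto_of_complete
    (NonarchimedeanAddGroup.cauchySeq_of_tendsto_sub_nhds_zero ?_)
  rw [Metric.tendsto_atTop]
  intro ε hε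
  have hε' : 0 < ε / (C + 1) := by positivity
  obtain ⟨δ, hδ, h⟩ := Metric.uniformContinuous_iff.1
    (CompactSpace.uniformContinuous_of_continuous f.continuous) _ hε'
  obtain ⟨N₀, hN₀⟩ := exists_pow_lt_of_lt_one hδ (inv_lt_one_of_one_lt₀
    (Nat.one_lt_cast.2 (Fact.out : p.Prime).one_lt) : (p : ℝ)⁻¹ < 1)
  refine ⟨N₀, fun N hN => ?_⟩
  have hdiff : μ.riemannSum f (N + 1) - μ.riemannSum f N
      = ∑ b ∈ Finset.range (p ^ N), ∑ i ∈ Finset.range p,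
        (f ((b + p ^ N * i : ℕ) : ℤ_[p]) - f (b : ℤ_[p])) *
          μ.toFun (padicResidueClass p (N + 1) ((b + p ^ N * i : ℕ) : ℤ_[p])) := by
    unfold riemannSum
    rw [padic_sum_range_pow_succ, ← Finset.sum_sub_distrib]
    refine Finset.sum_congr rfl fun b hb => ?_
    rw [μ.toPadicDistribution.apply_residueClass_eq_sum N b (Finset.mem_range.1 hb),
      Finset.mul_sum, ← Finset.sum_sub_distrib]
    exact Finset.sum_congr rfl fun i _ => by ring
  rw [dist_zero_right, hdiff]
  have hle : ‖∑ b ∈ Finset.range (p ^ N), ∑ i ∈ Finset.range p,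
        (f ((b + p ^ N * i : ℕ) : ℤ_[p]) - f (b : ℤ_[p])) *
          μ.toFun (padicResidueClass p (N + 1) ((b + p ^ N * i : ℕ) : ℤ_[p]))‖
      ≤ ε / (C + 1) * C := by
    refine IsUltrametricDist.norm_sum_le_of_forall_le_of_nonneg (by positivity) fun b _ =>
      IsUltrametricDist.norm_sum_le_of_forall_le_of_nonneg (by positivity) fun i _ => ?_
    rw [norm_mul]
    refine mul_le_mul ?_ (hC _) (norm_nonneg _) hε'.le
    rw [← dist_eq_norm]
    refine (h ?_).le
    rw [dist_eq_norm]
    refine lt_of_le_of_lt ?_ hN₀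
    have := (PadicInt.norm_le_pow_iff_mem_span_pow
      (((b + p ^ N * i : ℕ) : ℤ_[p]) - (b : ℤ_[p])) N₀).2
      (Ideal.mem_span_singleton.2 ((pow_dvd_pow _ hN).trans ⟨i, by push_cast; ring⟩))
    simpa [zpow_neg] using this
  refine hle.trans_lt ?_
  rw [div_mul_eq_mul_div, div_lt_iff₀ (by positivity)]
  nlinarith

/-- The integral `f ↦ μ(f) = ∫ f dμ` of continuous functions, as the limit of Riemann sums. -/
noncomputable def integral (μ : PadicMeasure p) : C(ℤ_[p], ℚ_[p]) →L[ℚ_[p]] ℚ_[p] :=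
  have spec : ∀ f, Filter.Tendsto (μ.riemannSum f) Filter.atTop
      (nhds (Filter.atTop.limUnder (μ.riemannSum f))) :=
    fun f => tendsto_nhds_limUnder (μ.riemannSum_tendsto f)
  LinearMap.mkContinuousOfExistsBound
    { toFun := fun f => Filter.atTop.limUnder (μ.riemannSum f)
      map_add' := fun f g => by
        refine tendsto_nhds_unique (spec (f + g)) (((spec f).add (spec g)).congr fun N => ?_)
        simp only [riemannSum, ← Finset.sum_add_distrib, ContinuousMap.add_apply, add_mul]
      map_smul' := fun c f => by
        refine tendsto_nhds_unique (spec (c • f)) (((spec f).const_mul c).congr fun N => ?_)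
        simp only [riemannSum, Finset.mul_sum, ContinuousMap.smul_apply, smul_eq_mul, mul_assoc] }
    (by
      obtain ⟨C, hC⟩ := μ.bounded'
      have hC0 : 0 ≤ C := (norm_nonneg _).trans (hC ⊥)
      refine ⟨C, fun f => le_of_tendsto (spec f).norm (Filter.Eventually.of_forall fun N => ?_)⟩
      refine IsUltrametricDist.norm_sum_le_of_forall_le_of_nonneg (by positivity) fun b _ => ?_
      rw [norm_mul, mul_comm]
      exact mul_le_mul (hC _) (f.norm_coe_le_norm _) (norm_nonneg _) hC0)

theorem tendsto_riemannSum_integral (μ : PadicMeasure p) (f : C(ℤ_[p], ℚ_[p])) :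
    Filter.Tendsto (μ.riemannSum f) Filter.atTop (nhds (μ.integral f)) :=
  tendsto_nhds_limUnder (μ.riemannSum_tendsto f)

end PadicMeasure

section PowerSeries

variable {p : ℕ} [Fact p.Prime]

/-- `f x = ∑ a_k x ^ k` for all `x ∈ ℤ_p`. -/
def HasPadicPowerSeries (f : C(ℤ_[p], ℚ_[p])) (a : ℕ → ℚ_[p]) : Prop :=
  ∀ x : ℤ_[p], HasSum (fun k => a k * (x : ℚ_[p]) ^ k) (f x)

theorem HasPadicPowerSeries.eq_zero {a : ℕ → ℚ_[p]}
    (h : HasPadicPowerSeries (0 : C(ℤ_[p], ℚ_[p])) a) : a = 0 := by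
  have hball : HasFPowerSeriesOnBall (fun _ : ℚ_[p] => (0 : ℚ_[p]))
      (FormalMultilinearSeries.ofScalars ℚ_[p] a) 0 1 := by
    constructor
    · rw [← ENNReal.coe_one]
      apply FormalMultilinearSeries.le_radius_of_tendsto (l := 0)
      have := (h 1).summable.tendsto_atTop_zero.norm
      simpa using this
    · simp
    · intro y hy
      rw [← ENNReal.coe_one, Metric.eball_coe, NNReal.coe_one, mem_ball_zero_iff] at hy
      have h' : HasSum (fun k => a k * y ^ k) 0 := h ⟨y, hy.le⟩
      simpa [mul_comm] using h'
  have h0 := hball.hasFPowerSeriesAt.eq_zero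
  rwa [FormalMultilinearSeries.ofScalars_series_eq_zero] at h0

theorem HasPadicPowerSeries.add {f g : C(ℤ_[p], ℚ_[p])} {a b : ℕ → ℚ_[p]}
    (hf : HasPadicPowerSeries f a) (hg : HasPadicPowerSeries g b) :
    HasPadicPowerSeries (f + g) (a + b) := fun x => by
  simpa [add_mul] using (hf x).add (hg x)

theorem HasPadicPowerSeries.smul (c : ℚ_[p]) {f : C(ℤ_[p], ℚ_[p])} {a : ℕ → ℚ_[p]}
    (hf : HasPadicPowerSeries f a) : HasPadicPowerSeries (c • f) (c • a) := fun x => by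
  simpa [mul_assoc] using (hf x).mul_left c

theorem HasPadicPowerSeries.unique {f : C(ℤ_[p], ℚ_[p])} {a b : ℕ → ℚ_[p]}
    (ha : HasPadicPowerSeries f a) (hb : HasPadicPowerSeries f b) : a = b := by
  have h := ha.add (hb.smul (-1))
  have h0 := HasPadicPowerSeries.eq_zero (a := a + (-1 : ℚ_[p]) • b)
    (by convert h using 1; simp)
  funext k
  have := congrFun h0 k
  simp only [Pi.add_apply, Pi.smul_apply, smul_eq_mul, Pi.zero_apply] at this
  linear_combination this

open Classical in
/-- The coefficients `a_k` of a function `f = ∑ a_k t ^ k`; they are unique, and they are `0` by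
convention if `f` is not given by a power series. -/
noncomputable def padicCoeff (f : C(ℤ_[p], ℚ_[p])) : ℕ → ℚ_[p] :=
  if h : ∃ a, HasPadicPowerSeries f a then h.choose else 0

theorem HasPadicPowerSeries.padicCoeff_eq {f : C(ℤ_[p], ℚ_[p])} {a : ℕ → ℚ_[p]}
    (h : HasPadicPowerSeries f a) : padicCoeff f = a := by
  have hex : ∃ a, HasPadicPowerSeries f a := ⟨a, h⟩
  rw [padicCoeff, dif_pos hex]
  exact hex.choose_spec.unique h

/-- Functions given by a power series `∑ a_k t ^ k` with `|a_k| ρ ^ k → 0`, for `ρ > 1`. -/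
def analyticSubmodule (p : ℕ) [Fact p.Prime] (ρ : Set.Ioi (1 : ℝ)) :
    Submodule ℚ_[p] C(ℤ_[p], ℚ_[p]) where
  carrier := {f | ∃ a, HasPadicPowerSeries f a ∧
    Filter.Tendsto (fun k => ‖a k‖ * (ρ : ℝ) ^ k) Filter.atTop (nhds 0)}
  zero_mem' := ⟨0, fun x => by simp, by simp⟩
  add_mem' := by
    rintro f g ⟨a, ha, ha'⟩ ⟨b, hb, hb'⟩
    have hρ : (0 : ℝ) < ρ := zero_lt_one.trans ρ.2
    refine ⟨a + b, ha.add hb, ?_⟩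
    have hlim := ha'.add hb'
    rw [add_zero] at hlim
    refine squeeze_zero (fun k => by positivity) (fun k => ?_) hlim
    rw [← add_mul]
    exact mul_le_mul_of_nonneg_right (norm_add_le _ _) (by positivity)
  smul_mem' := by
    rintro c f ⟨a, ha, ha'⟩
    refine ⟨c • a, ha.smul c, ?_⟩
    simpa [mul_assoc] using ha'.const_mul ‖c‖

end PowerSeries

/-- The space `C^an_ρ(ℤ_p, ℚ_p)` of analytic functions of radius of convergence `≥ ρ`, for
`ρ > 1`. This is a type of its own, since its topology is not the one of uniform convergence. -/
def PadicAnalytic (p : ℕ) [Fact p.Prime] (ρ : Set.Ioi (1 : ℝ)) : Type :=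
  ↥(analyticSubmodule p ρ)

namespace PadicAnalytic

variable {p : ℕ} [Fact p.Prime] {ρ : Set.Ioi (1 : ℝ)}

noncomputable instance : AddCommGroup (PadicAnalytic p ρ) :=
  inferInstanceAs (AddCommGroup ↥(analyticSubmodule p ρ))

noncomputable instance : Module ℚ_[p] (PadicAnalytic p ρ) :=
  inferInstanceAs (Module ℚ_[p] ↥(analyticSubmodule p ρ))

/-- The underlying continuous function. -/
noncomputable def toContinuousMap : PadicAnalytic p ρ →ₗ[ℚ_[p]] C(ℤ_[p], ℚ_[p]) :=
  (analyticSubmodule p ρ).subtype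

theorem hasPadicPowerSeries (f : PadicAnalytic p ρ) :
    HasPadicPowerSeries f.toContinuousMap (padicCoeff f.toContinuousMap) := by
  obtain ⟨a, ha, -⟩ := f.2
  have := HasPadicPowerSeries.padicCoeff_eq (f := toContinuousMap f) ha
  rw [this]; exact ha

theorem tendsto_padicCoeff (f : PadicAnalytic p ρ) :
    Filter.Tendsto (fun k => ‖padicCoeff f.toContinuousMap k‖ * (ρ : ℝ) ^ k)
      Filter.atTop (nhds 0) := by
  obtain ⟨a, ha, ha'⟩ := f.2
  have := HasPadicPowerSeries.padicCoeff_eq (f := toContinuousMap f) ha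
  rw [this]; exact ha'

theorem padicCoeff_add (f g : PadicAnalytic p ρ) : padicCoeff (f + g).toContinuousMap
    = padicCoeff f.toContinuousMap + padicCoeff g.toContinuousMap := by
  rw [map_add]
  exact (f.hasPadicPowerSeries.add g.hasPadicPowerSeries).padicCoeff_eq

theorem padicCoeff_smul (c : ℚ_[p]) (f : PadicAnalytic p ρ) :
    padicCoeff (c • f).toContinuousMap = c • padicCoeff f.toContinuousMap := by
  rw [map_smul]
  exact (f.hasPadicPowerSeries.smul c).padicCoeff_eq

theorem ρ_pos : (0 : ℝ) < ρ := zero_lt_one.trans ρ.2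

/-- The norm `|f|_ρ = sup_k |a_k| ρ ^ k`. -/
noncomputable instance : Norm (PadicAnalytic p ρ) :=
  ⟨fun f => ⨆ k, ‖padicCoeff f.toContinuousMap k‖ * (ρ : ℝ) ^ k⟩

theorem norm_def (f : PadicAnalytic p ρ) :
    ‖f‖ = ⨆ k, ‖padicCoeff f.toContinuousMap k‖ * (ρ : ℝ) ^ k := rfl

theorem le_norm (f : PadicAnalytic p ρ) (k : ℕ) :
    ‖padicCoeff f.toContinuousMap k‖ * (ρ : ℝ) ^ k ≤ ‖f‖ :=
  le_ciSup f.tendsto_padicCoeff.bddAbove_range k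

theorem norm_nonneg' (f : PadicAnalytic p ρ) : 0 ≤ ‖f‖ :=
  le_trans (by have := ρ_pos (ρ := ρ); positivity) (f.le_norm 0)

theorem norm_smul_le' (c : ℚ_[p]) (f : PadicAnalytic p ρ) : ‖c • f‖ ≤ ‖c‖ * ‖f‖ := by
  rw [norm_def]
  refine ciSup_le fun k => ?_
  rw [padicCoeff_smul, Pi.smul_apply, norm_smul, mul_assoc]
  exact mul_le_mul_of_nonneg_left (f.le_norm k) (norm_nonneg c)

noncomputable instance : NormedAddCommGroup (PadicAnalytic p ρ) :=
  AddGroupNorm.toNormedAddCommGroup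
    { toFun := fun f => ‖f‖
      map_zero' := by
        refine le_antisymm ?_ (norm_nonneg' 0)
        have := norm_smul_le' (0 : ℚ_[p]) (0 : PadicAnalytic p ρ)
        simpa using this
      add_le' := fun f g => by
        rw [norm_def (f + g)]
        refine ciSup_le fun k => ?_
        rw [padicCoeff_add, Pi.add_apply]
        have h1 := f.le_norm k
        have h2 := g.le_norm k
        have h3 := mul_le_mul_of_nonneg_right
          (norm_add_le (padicCoeff f.toContinuousMap k) (padicCoeff g.toContinuousMap k))
          (pow_pos (ρ_pos (ρ := ρ)) k).le
        linarith
      neg' := fun f => by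
        have h : ∀ g : PadicAnalytic p ρ, ‖-g‖ ≤ ‖g‖ := fun g => by
          simpa using norm_smul_le' (-1 : ℚ_[p]) g
        refine le_antisymm (h f) ?_
        have := h (-f)
        rwa [neg_neg] at this
      eq_zero_of_map_eq_zero' := fun f hf => by
        have hc : padicCoeff f.toContinuousMap = 0 := by
          funext k
          have h1 : ‖padicCoeff f.toContinuousMap k‖ * (ρ : ℝ) ^ k ≤ 0 := (f.le_norm k).trans hf.le
          have h2 := pow_pos (ρ_pos (ρ := ρ)) k
          have h3 : ‖padicCoeff f.toContinuousMap k‖ ≤ 0 := by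
            by_contra h4
            exact absurd h1 (not_le.2 (mul_pos (not_le.1 h4) h2))
          exact norm_le_zero_iff.1 h3
        refine Subtype.ext (ContinuousMap.ext fun x => ?_)
        have h := f.hasPadicPowerSeries x
        rw [hc] at h
        simp only [Pi.zero_apply, zero_mul] at h
        exact h.unique hasSum_zero }

end PadicAnalytic

/-- The functions which belong to `C^an_ρ(ℤ_p, ℚ_p)` for some `ρ > 1`. -/
def overconvergentSubmodule (p : ℕ) [Fact p.Prime] : Submodule ℚ_[p] C(ℤ_[p], ℚ_[p]) where
  carrier := {f | ∃ ρ : Set.Ioi (1 : ℝ), f ∈ analyticSubmodule p ρ}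
  zero_mem' := ⟨⟨2, Set.mem_Ioi.2 one_lt_two⟩, Submodule.zero_mem _⟩
  add_mem' := by
    have mono : ∀ ρ σ : Set.Ioi (1 : ℝ), ρ ≤ σ → analyticSubmodule p σ ≤ analyticSubmodule p ρ := by
      rintro ρ σ h f ⟨a, ha, ha'⟩
      have hρ : (0 : ℝ) < ρ := zero_lt_one.trans ρ.2
      refine ⟨a, ha, squeeze_zero (fun k => by positivity) (fun k => ?_) ha'⟩
      exact mul_le_mul_of_nonneg_left (pow_le_pow_left₀ hρ.le h k) (norm_nonneg _)
    rintro f g ⟨ρ, hf⟩ ⟨σ, hg⟩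
    exact ⟨min ρ σ, Submodule.add_mem _ (mono _ _ (min_le_left _ _) hf)
      (mono _ _ (min_le_right _ _) hg)⟩
  smul_mem' := fun c _ ⟨ρ, hf⟩ => ⟨ρ, Submodule.smul_mem _ c hf⟩

theorem mem_overconvergentSubmodule {p : ℕ} [Fact p.Prime] {f : C(ℤ_[p], ℚ_[p])} :
    f ∈ overconvergentSubmodule p ↔ ∃ ρ : Set.Ioi (1 : ℝ), f ∈ analyticSubmodule p ρ := Iff.rfl

/-- The space `C^†(ℤ_p, ℚ_p) = colim_{ρ > 1} C^an_ρ(ℤ_p, ℚ_p)` of overconvergent functions. -/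
def Overconvergent (p : ℕ) [Fact p.Prime] : Type :=
  ↥(overconvergentSubmodule p)

namespace Overconvergent

variable {p : ℕ} [Fact p.Prime]

noncomputable instance : AddCommGroup (Overconvergent p) :=
  inferInstanceAs (AddCommGroup ↥(overconvergentSubmodule p))

noncomputable instance : Module ℚ_[p] (Overconvergent p) :=
  inferInstanceAs (Module ℚ_[p] ↥(overconvergentSubmodule p))

/-- The inclusion of `C^an_ρ(ℤ_p, ℚ_p)` into `C^†(ℤ_p, ℚ_p)`. -/
noncomputable def ofAnalytic (ρ : Set.Ioi (1 : ℝ)) : PadicAnalytic p ρ →ₗ[ℚ_[p]] Overconvergent p :=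
  Submodule.inclusion (show analyticSubmodule p ρ ≤ overconvergentSubmodule p from
    fun _ hf => mem_overconvergentSubmodule.2 ⟨ρ, hf⟩)

/-- The inductive limit topology: a map out of `C^†(ℤ_p, ℚ_p)`, in particular a linear functional,
is continuous if and only if its restriction to each `C^an_ρ(ℤ_p, ℚ_p)` is continuous. -/
noncomputable instance : TopologicalSpace (Overconvergent p) :=
  ⨆ ρ : Set.Ioi (1 : ℝ), TopologicalSpace.coinduced (ofAnalytic ρ) inferInstance

theorem continuous_iff {Y : Type*} [TopologicalSpace Y] {T : Overconvergent p → Y} :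
    Continuous T ↔ ∀ ρ, Continuous (T ∘ ofAnalytic ρ) := by
  rw [continuous_iSup_dom]
  exact forall_congr' fun ρ => continuous_coinduced_dom

theorem continuous_ofAnalytic (ρ : Set.Ioi (1 : ℝ)) :
    Continuous (ofAnalytic ρ : PadicAnalytic p ρ → Overconvergent p) :=
  continuous_iff.1 continuous_id ρ

/-- The coefficients `a_k` of an overconvergent function `f = ∑ a_k t ^ k`. -/
noncomputable def coeff (f : Overconvergent p) : ℕ → ℚ_[p] :=
  padicCoeff f.1

theorem exists_eq_ofAnalytic (f : Overconvergent p) :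
    ∃ (ρ : Set.Ioi (1 : ℝ)) (g : PadicAnalytic p ρ), ofAnalytic ρ g = f := by
  obtain ⟨ρ, hf⟩ := mem_overconvergentSubmodule.1 f.2
  exact ⟨ρ, ⟨f.1, hf⟩, rfl⟩

theorem coeff_ofAnalytic {ρ : Set.Ioi (1 : ℝ)} (g : PadicAnalytic p ρ) :
    (ofAnalytic ρ g).coeff = padicCoeff g.toContinuousMap := rfl

theorem hasPadicPowerSeries_coeff (f : Overconvergent p) : HasPadicPowerSeries f.1 f.coeff := by
  obtain ⟨ρ, g, rfl⟩ := f.exists_eq_ofAnalytic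
  exact g.hasPadicPowerSeries

theorem coeff_add (f g : Overconvergent p) : (f + g).coeff = f.coeff + g.coeff :=
  (f.hasPadicPowerSeries_coeff.add g.hasPadicPowerSeries_coeff).padicCoeff_eq

theorem coeff_smul (c : ℚ_[p]) (f : Overconvergent p) : (c • f).coeff = c • f.coeff :=
  (f.hasPadicPowerSeries_coeff.smul c).padicCoeff_eq

/-- The inclusion `C^†(ℤ_p, ℚ_p) → C(ℤ_p, ℚ_p)`. -/
noncomputable def toContinuousMap : Overconvergent p →L[ℚ_[p]] C(ℤ_[p], ℚ_[p]) where
  toLinearMap := (overconvergentSubmodule p).subtype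
  cont := by
    refine continuous_iff.2 fun ρ => ?_
    refine AddMonoidHomClass.continuous_of_bound
      (PadicAnalytic.toContinuousMap : PadicAnalytic p ρ →ₗ[ℚ_[p]] C(ℤ_[p], ℚ_[p])) 1 fun f => ?_
    rw [one_mul, ContinuousMap.norm_le _ (norm_nonneg f)]
    intro x
    refine le_of_tendsto (f.hasPadicPowerSeries x).norm (Filter.Eventually.of_forall fun s => ?_)
    refine IsUltrametricDist.norm_sum_le_of_forall_le_of_nonneg (norm_nonneg f) fun k _ => ?_
    refine le_trans ?_ (f.le_norm k)
    rw [norm_mul, norm_pow]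
    have h1 : ‖(x : ℚ_[p])‖ ≤ ρ := x.2.trans (le_of_lt ρ.2)
    gcongr

/-- The operator `f ↦ f(α t)` on `C^†(ℤ_p, ℚ_p)`, for a `p`-adic unit `α`. -/
noncomputable def dilate (α : ℤ_[p]ˣ) : Overconvergent p →L[ℚ_[p]] Overconvergent p :=
  have key : ∀ {f : C(ℤ_[p], ℚ_[p])} {a : ℕ → ℚ_[p]}, HasPadicPowerSeries f a →
      HasPadicPowerSeries (f.comp (ContinuousMap.mulLeft (α : ℤ_[p])))
        (fun k => ((α : ℤ_[p]) : ℚ_[p]) ^ k * a k) := fun {f a} h x => by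
    have := h ((α : ℤ_[p]) * x)
    show HasSum _ (f ((α : ℤ_[p]) * x))
    convert this using 2 with k
    push_cast
    ring
  have hnorm : ∀ (k : ℕ) (y : ℚ_[p]), ‖((α : ℤ_[p]) : ℚ_[p]) ^ k * y‖ = ‖y‖ := fun k y => by
    rw [norm_mul, norm_pow, ← PadicInt.norm_def, PadicInt.norm_units, one_pow, one_mul]
  have mem : ∀ {ρ : Set.Ioi (1 : ℝ)} {f : C(ℤ_[p], ℚ_[p])}, f ∈ analyticSubmodule p ρ →
      f.comp (ContinuousMap.mulLeft (α : ℤ_[p])) ∈ analyticSubmodule p ρ := by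
    rintro ρ f ⟨a, ha, ha'⟩
    refine ⟨_, key ha, ?_⟩
    simpa only [hnorm] using ha'
  { toFun := fun f => ⟨f.1.comp (ContinuousMap.mulLeft (α : ℤ_[p])),
      by
        obtain ⟨ρ, hf⟩ := mem_overconvergentSubmodule.1 f.2
        exact mem_overconvergentSubmodule.2 ⟨ρ, mem hf⟩⟩
    map_add' := fun _ _ => rfl
    map_smul' := fun _ _ => rfl
    cont := by
      refine continuous_iff.2 fun ρ => ?_
      let T : PadicAnalytic p ρ →ₗ[ℚ_[p]] PadicAnalytic p ρ :=
        { toFun := fun f => ⟨f.1.comp (ContinuousMap.mulLeft (α : ℤ_[p])), mem f.2⟩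
          map_add' := fun _ _ => rfl
          map_smul' := fun _ _ => rfl }
      have hT : Continuous T := by
        refine AddMonoidHomClass.continuous_of_bound T 1 fun f => ?_
        rw [one_mul, PadicAnalytic.norm_def]
        refine ciSup_le fun k => ?_
        have : padicCoeff (T f).toContinuousMap = _ := (key f.hasPadicPowerSeries).padicCoeff_eq
        rw [this, hnorm]
        exact f.le_norm k
      exact (continuous_ofAnalytic ρ).comp hT }

theorem dilate_apply (α : ℤ_[p]ˣ) (f : Overconvergent p) (t : ℤ_[p]) :
    (dilate α f).toContinuousMap t = f.toContinuousMap (α * t) := rfl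

end Overconvergent

theorem padic_norm_bernoulli_le (p : ℕ) [Fact p.Prime] (k : ℕ) :
    ‖((bernoulli k : ℚ) : ℚ_[p])‖ ≤ p := by
  have hp1 : (1 : ℝ) ≤ p := by exact_mod_cast (Fact.out : p.Prime).one_lt.le
  have hprime : ∀ q : ℕ, q.Prime → ‖(((1 : ℚ) / q : ℚ) : ℚ_[p])‖ ≤ p := by
    intro q hq
    push_cast
    rw [norm_div, norm_one]
    by_cases h : q = p
    · subst h
      rw [Padic.norm_p]; simp
    · have : ‖(q : ℚ_[p])‖ = 1 := by
        rw [Padic.norm_natCast_eq_one_iff]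
        exact (Nat.coprime_primes Fact.out hq).2 (Ne.symm h)
      rw [this, div_one]; exact hp1
  rcases Nat.even_or_odd' k with ⟨m, rfl | rfl⟩
  · obtain ⟨z, hz⟩ := Bernoulli.vonStaudt_clausen m
    rw [eq_sub_of_add_eq hz.symm, Rat.cast_sub, Rat.cast_sum, sub_eq_add_neg]
    refine (IsUltrametricDist.norm_add_le_max _ _).trans (max_le ?_ ?_)
    · rw [Rat.cast_intCast]
      exact (Padic.norm_int_le_one z).trans hp1
    · rw [norm_neg]
      refine IsUltrametricDist.norm_sum_le_of_forall_le_of_nonneg (by positivity) fun q hq => ?_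
      exact hprime q (Finset.mem_filter.1 hq).2.1
  · rcases Nat.eq_zero_or_pos m with rfl | hm
    · have : bernoulli (2 * 0 + 1) = -((1 : ℚ) / (2 : ℕ)) := by
        rw [mul_zero, zero_add, bernoulli_one]; norm_num
      rw [this, Rat.cast_neg, norm_neg]
      exact hprime 2 Nat.prime_two
    · rw [bernoulli_eq_zero_of_odd ⟨m, rfl⟩ (by omega)]
      simp

theorem padic_norm_bernoulli_div_le (p : ℕ) [Fact p.Prime] (n k : ℕ) :
    ‖(n : ℚ_[p]) * ((bernoulli (k + n) / ((k + n : ℕ) : ℚ) : ℚ) : ℚ_[p])‖ ≤ p * (k + n : ℕ) := by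
  have hp1 : (1 : ℝ) ≤ p := by exact_mod_cast (Fact.out : p.Prime).one_lt.le
  rcases Nat.eq_zero_or_pos (k + n) with h | h
  · simp [h]
  · have hinv : ‖((k + n : ℕ) : ℚ_[p])‖⁻¹ ≤ (k + n : ℕ) := by
      have h0 : (k + n : ℕ) ≠ 0 := h.ne'
      rw [Padic.norm_eq_zpow_neg_valuation (Nat.cast_ne_zero.2 h0), zpow_neg, inv_inv,
        Padic.valuation_natCast, zpow_natCast]
      exact_mod_cast Nat.le_of_dvd h pow_padicValNat_dvd
    rw [norm_mul, Rat.cast_div, norm_div, Rat.cast_natCast, div_eq_mul_inv]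
    have h1 : ‖(n : ℚ_[p])‖ ≤ 1 := by simpa using Padic.norm_int_le_one (p := p) (n : ℤ)
    have h2 := padic_norm_bernoulli_le p (k + n)
    calc ‖(n : ℚ_[p])‖ * (‖((bernoulli (k + n) : ℚ) : ℚ_[p])‖ * ‖((k + n : ℕ) : ℚ_[p])‖⁻¹)
        ≤ 1 * (p * (k + n : ℕ)) := by gcongr
      _ = _ := one_mul _

theorem bernoulliFunctional_bound (p : ℕ) [Fact p.Prime] (n : ℕ) (ρ : Set.Ioi (1 : ℝ)) :
    ∃ C : ℝ, 0 ≤ C ∧ ∀ k : ℕ,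
      ‖(n : ℚ_[p]) * ((bernoulli (k + n) / ((k + n : ℕ) : ℚ) : ℚ) : ℚ_[p])‖ ≤ C * (ρ : ℝ) ^ k := by
  have hρ1 : (1 : ℝ) < ρ := ρ.2
  have hρ : (0 : ℝ) < ρ := zero_lt_one.trans hρ1
  have h1 := tendsto_self_mul_const_pow_of_lt_one (inv_pos.2 hρ).le (inv_lt_one_of_one_lt₀ hρ1)
  obtain ⟨D, hD⟩ := h1.bddAbove_range
  have hD' : ∀ k : ℕ, (k : ℝ) ≤ D * (ρ : ℝ) ^ k := fun k => by
    have := hD ⟨k, rfl⟩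
    simp only [inv_pow] at this
    rwa [← div_eq_mul_inv, div_le_iff₀ (pow_pos hρ k)] at this
  have hD0 : 0 ≤ D := by simpa using hD' 0
  refine ⟨p * (D + n), by positivity, fun k => (padic_norm_bernoulli_div_le p n k).trans ?_⟩
  rw [mul_assoc]
  refine mul_le_mul_of_nonneg_left ?_ (by positivity)
  have h2 : (1 : ℝ) ≤ (ρ : ℝ) ^ k := one_le_pow₀ hρ1.le
  have h3 : (n : ℝ) ≤ n * (ρ : ℝ) ^ k := le_mul_of_one_le_right (by positivity) h2
  push_cast
  linarith [hD' k]

theorem hasSum_bernoulliFunctional_aux (p : ℕ) [Fact p.Prime] (n : ℕ) (f : Overconvergent p) :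
    HasSum (fun k : ℕ =>
        n * f.coeff k * ((bernoulli (k + n) / ((k + n : ℕ) : ℚ) : ℚ) : ℚ_[p]))
      (∑' k : ℕ, n * f.coeff k * ((bernoulli (k + n) / ((k + n : ℕ) : ℚ) : ℚ) : ℚ_[p])) := by
  obtain ⟨ρ, g, rfl⟩ := f.exists_eq_ofAnalytic
  obtain ⟨C, hC0, hC⟩ := bernoulliFunctional_bound p n ρ
  refine (NonarchimedeanAddGroup.summable_of_tendsto_cofinite_zero ?_).hasSum
  rw [Nat.cofinite_eq_atTop]
  have hlim := g.tendsto_padicCoeff.const_mul C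
  rw [mul_zero] at hlim
  refine squeeze_zero_norm (fun k => ?_) hlim
  rw [mul_right_comm, norm_mul, Overconvergent.coeff_ofAnalytic]
  calc _ ≤ C * (ρ : ℝ) ^ k * ‖padicCoeff g.toContinuousMap k‖ := by gcongr; exact hC k
    _ = _ := by ring

/-- The linear functional `∑ a_k t ^ k ↦ ∑ n a_k B_{k+n} / (k + n)`. -/
noncomputable def bernoulliLinearFunctional (p : ℕ) [Fact p.Prime] (n : ℕ) :
    Overconvergent p →ₗ[ℚ_[p]] ℚ_[p] where
  toFun f := ∑' k : ℕ, n * f.coeff k * ((bernoulli (k + n) / ((k + n : ℕ) : ℚ) : ℚ) : ℚ_[p])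
  map_add' f g := by
    refine (hasSum_bernoulliFunctional_aux p n (f + g)).unique
      (Eq.mp (congrArg (HasSum · _) (funext fun k => ?_))
        ((hasSum_bernoulliFunctional_aux p n f).add
        (hasSum_bernoulliFunctional_aux p n g)))
    rw [Overconvergent.coeff_add, Pi.add_apply]; ring
  map_smul' c f := by
    refine (hasSum_bernoulliFunctional_aux p n (c • f)).unique
      (Eq.mp (congrArg (HasSum · _) (funext fun k => ?_))
        ((hasSum_bernoulliFunctional_aux p n f).mul_left c))
    rw [Overconvergent.coeff_smul, Pi.smul_apply, smul_eq_mul]; ring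

/-- The `n`-th Bernoulli functional `∑ a_k t ^ k ↦ ∑ n a_k B_{k+n} / (k + n)` as a continuous
linear functional. For `n = 0` all summands vanish (the one with `k = n = 0` by convention), so
that it is the zero functional. -/
noncomputable def bernoulliFunctional (p : ℕ) [Fact p.Prime] (n : ℕ) :
    Overconvergent p →L[ℚ_[p]] ℚ_[p] where
  toLinearMap := bernoulliLinearFunctional p n
  cont := by
    refine Overconvergent.continuous_iff.2 fun ρ => ?_
    obtain ⟨C, hC0, hC⟩ := bernoulliFunctional_bound p n ρ
    refine AddMonoidHomClass.continuous_of_bound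
      (bernoulliLinearFunctional p n ∘ₗ Overconvergent.ofAnalytic ρ) C fun f => ?_
    refine le_of_tendsto
      (hasSum_bernoulliFunctional_aux p n (Overconvergent.ofAnalytic ρ f)).norm
      (Filter.Eventually.of_forall fun s => ?_)
    refine IsUltrametricDist.norm_sum_le_of_forall_le_of_nonneg
      (mul_nonneg hC0 (norm_nonneg f)) fun k _ => ?_
    rw [mul_right_comm, norm_mul, Overconvergent.coeff_ofAnalytic]
    calc _ ≤ C * (ρ : ℝ) ^ k * ‖padicCoeff f.toContinuousMap k‖ := by gcongr; exact hC k
      _ = C * (‖padicCoeff f.toContinuousMap k‖ * (ρ : ℝ) ^ k) := by ring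
      _ ≤ C * ‖f‖ := by gcongr; exact f.le_norm k

theorem hasSum_bernoulliFunctional (p : ℕ) [Fact p.Prime] (n : ℕ) (f : Overconvergent p) :
    HasSum (fun k : ℕ =>
        n * f.coeff k * ((bernoulli (k + n) / ((k + n : ℕ) : ℚ) : ℚ) : ℚ_[p]))
      (bernoulliFunctional p n f) :=
  hasSum_bernoulliFunctional_aux p n f

/-! Both sides can be evaluated term by term on a power series, so everything reduces to the moments
of `μ_{n,α}`: the integral of `t ^ k` must be `(1 - α ^ (k + n)) * n * B_{k+n} / (k + n)`, the
factor `α ^ (k + n)` being the product of `α ^ n` and the `α ^ k` that comes from `t ↦ α t`.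

For `0 ≤ b < p ^ N` let `c` be the representative of `α⁻¹ b` modulo `p ^ N`. Expanding the Bernoulli
polynomial writes the Riemann sum of `t ^ k` as a combination over `i ≤ n`, with coefficients `B_i *
choose n i`, of the sums `p ^ (N (i - 1)) * ∑ b ^ k (b ^ (n - i) - α ^ n c ^ (n - i))`. For `i ≥ 1`
the weight is integral and the sums over `b` tend to `0`. Only `i = 0` has a denominator `p ^ N`,
and it carries the whole limit.

For `i = 0`, put `x = b` and `y = α c`, so that `p ^ N ∣ x - y`. The congruence `(k + n) x ^ k (x ^
n - y ^ n) ≡ n (x ^ (k + n) - y ^ (k + n))` modulo `(x - y) ^ 2` holds modulo `p ^ (2 N)`, hence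
survives division by `p ^ N`. As `c` runs over all residues together with `b`, the right-hand side
sums to `n (1 - α ^ (k + n)) ∑ b ^ (k + n)`, and `p ^ (-N) ∑ b ^ (k + n)` tends to `B_{k+n}`. This
is `tendsto_inv_pow_mul_sum_pow_mul_sub`, the heart of the proof;
`integral_regularizedBernoulliMeasure_monomial` gives the moments and `hasSum_toContinuousMap` the
passage to power series. -/

/-- Expand in powers of `y - x`: the linear terms on the two sides are both `-n (k + n) x ^ (k + n -
1) (y - x)`, so they cancel. Working modulo the square is what later permits a division by `p ^ N`.
-/
theorem sub_sq_dvd_add_mul_pow_mul_sub {R : Type*} [CommRing R] (x y : R) (k n : ℕ) :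
    (x - y) ^ 2 ∣ ((k + n : ℕ) : R) * (x ^ k * (x ^ n - y ^ n)) -
      n * (x ^ (k + n) - y ^ (k + n)) := by
  obtain ⟨A, hA⟩ := Polynomial.powAddExpansion x (y - x) n
  obtain ⟨B, hB⟩ := Polynomial.powAddExpansion x (y - x) (k + n)
  rw [add_sub_cancel] at hA hB
  refine ⟨n * B - ((k + n : ℕ) : R) * x ^ k * A, ?_⟩
  rw [hA, hB]
  -- The linear coefficients contain the truncated exponents `n - 1` and `k + n - 1`. They are
  -- genuine for `n > 0`; for `n = 0` the offending terms have the factor `n`.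
  rcases n with _ | n
  · simp; ring
  · rw [← Nat.add_assoc, Nat.add_sub_cancel, Nat.add_sub_cancel]
    push_cast
    ring

/-! ### `p`-adic limits of power sums -/

theorem padic_tendsto_natCast_pow_zero (p : ℕ) [Fact p.Prime] :
    Filter.Tendsto (fun N : ℕ => (p : ℚ_[p]) ^ N) Filter.atTop (nhds 0) :=
  tendsto_pow_atTop_nhds_zero_of_norm_lt_one Padic.norm_p_lt_one

/-- A sequence whose `N`-th term lies in `p ^ N ℤ_p` tends to `0`. -/
theorem padic_tendsto_zero_of_dvd {p : ℕ} [Fact p.Prime] {x : ℕ → ℚ_[p]}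
    (h : ∀ N, ∃ z : ℤ_[p], x N = (p : ℚ_[p]) ^ N * z) :
    Filter.Tendsto x Filter.atTop (nhds 0) := by
  refine squeeze_zero_norm (fun N => ?_)
    (tendsto_zero_iff_norm_tendsto_zero.1 (padic_tendsto_natCast_pow_zero p))
  obtain ⟨z, hz⟩ := h N
  rw [hz, norm_mul]
  exact mul_le_of_le_one_right (norm_nonneg _) z.norm_le_one

/-- The Volkenborn integral of `t ^ m` is the Bernoulli number `B_m`. -/
theorem padic_tendsto_inv_pow_mul_sum_pow (p : ℕ) [Fact p.Prime] (m : ℕ) :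
    Filter.Tendsto (fun N : ℕ => ((p : ℚ_[p]) ^ N)⁻¹ * ∑ b ∈ Finset.range (p ^ N), (b : ℚ_[p]) ^ m)
      Filter.atTop (nhds ((bernoulli m : ℚ) : ℚ_[p])) := by
  have hp : (p : ℚ_[p]) ≠ 0 := Nat.cast_ne_zero.2 (Fact.out : p.Prime).ne_zero
  have hm : (m : ℚ_[p]) + 1 ≠ 0 := by exact_mod_cast m.succ_ne_zero
  have h : ∀ N : ℕ, ((p : ℚ_[p]) ^ N)⁻¹ * ∑ b ∈ Finset.range (p ^ N), (b : ℚ_[p]) ^ m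
      = ∑ i ∈ Finset.range (m + 1), ((bernoulli i : ℚ) : ℚ_[p]) * ((m + 1).choose i) / (m + 1) *
        ((p : ℚ_[p]) ^ N) ^ (m - i) := by
    intro N
    -- Faulhaber's formula: every term contains `(p ^ N) ^ (m + 1 - i)` with `i ≤ m`, so one factor
    -- `p ^ N` can be cancelled.
    have hs := congrArg (Rat.cast : ℚ → ℚ_[p]) (sum_range_pow (p ^ N) m)
    push_cast at hs
    rw [hs, Finset.mul_sum]
    refine Finset.sum_congr rfl fun i hi => ?_
    rw [Nat.succ_sub (Nat.lt_succ_iff.1 (Finset.mem_range.1 hi)), pow_succ]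
    field_simp
  simp only [h]
  have hlim := tendsto_finsetSum (Finset.range (m + 1)) fun i _ =>
    ((padic_tendsto_natCast_pow_zero p).pow (m - i)).const_mul
      (((bernoulli i : ℚ) : ℚ_[p]) * ((m + 1).choose i) / (m + 1))
  convert hlim using 2
  -- Only `i = m` has no power of `p ^ N` left; its coefficient is `B_m * (m + 1) / (m + 1)`.
  rw [Finset.sum_eq_single_of_mem m (Finset.mem_range.2 m.lt_succ_self)]
  · simp only [Nat.sub_self, pow_zero, mul_one, Nat.choose_succ_self_right]
    push_cast
    field_simp
  · intro i hi him
    have : m - i ≠ 0 := by have := Finset.mem_range.1 hi; omega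
    rw [zero_pow this, mul_zero]

/-- The sum is `p ^ N` times a convergent sequence. This disposes of the terms `i ≥ 1` of the
Bernoulli polynomial, where no division by `p ^ N` occurs. -/
theorem padic_tendsto_sum_pow (p : ℕ) [Fact p.Prime] (m : ℕ) :
    Filter.Tendsto (fun N : ℕ => ∑ b ∈ Finset.range (p ^ N), (b : ℚ_[p]) ^ m)
      Filter.atTop (nhds 0) := by
  have hp : (p : ℚ_[p]) ≠ 0 := Nat.cast_ne_zero.2 (Fact.out : p.Prime).ne_zero
  have h := (padic_tendsto_natCast_pow_zero p).mul (padic_tendsto_inv_pow_mul_sum_pow p m)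
  rw [zero_mul] at h
  refine h.congr fun N => ?_
  rw [mul_inv_cancel_left₀ (pow_ne_zero _ hp)]

/-! ### Multiplication by a unit on representatives modulo `p ^ N` -/

section UnitInverse

variable {p : ℕ} [Fact p.Prime]

/-- The representative in `[0, p ^ N)` of `α * b` modulo `p ^ N`. -/
noncomputable def padicUnitMulRep (α : ℤ_[p]ˣ) (N b : ℕ) : ℕ :=
  (padic_exists_natCast_rep N ((α : ℤ_[p]) * (b : ℤ_[p]))).choose

theorem padicUnitMulRep_lt (α : ℤ_[p]ˣ) (N b : ℕ) : padicUnitMulRep α N b < p ^ N :=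
  (padic_exists_natCast_rep N ((α : ℤ_[p]) * (b : ℤ_[p]))).choose_spec.1

theorem dvd_mul_sub_padicUnitMulRep (α : ℤ_[p]ˣ) (N b : ℕ) :
    (p : ℤ_[p]) ^ N ∣ (α : ℤ_[p]) * (b : ℤ_[p]) - padicUnitMulRep α N b :=
  (padic_exists_natCast_rep N ((α : ℤ_[p]) * (b : ℤ_[p]))).choose_spec.2

theorem dvd_sub_mul_padicUnitMulRep_inv (α : ℤ_[p]ˣ) (N b : ℕ) :
    (p : ℤ_[p]) ^ N ∣ (b : ℤ_[p]) - (α : ℤ_[p]) * padicUnitMulRep α⁻¹ N b := by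
  have := (dvd_mul_sub_padicUnitMulRep α⁻¹ N b).mul_left (α : ℤ_[p])
  rwa [mul_sub, Units.mul_inv_cancel_left] at this

theorem padicUnitMulRep_inv_padicUnitMulRep (α : ℤ_[p]ˣ) {N b : ℕ} (hb : b < p ^ N) :
    padicUnitMulRep α⁻¹ N (padicUnitMulRep α N b) = b := by
  refine padic_natCast_rep_unique (padicUnitMulRep_lt _ _ _) hb ?_
  have h := dvd_add (dvd_mul_sub_padicUnitMulRep α N b)
    (dvd_sub_mul_padicUnitMulRep_inv α N (padicUnitMulRep α N b))
  rw [sub_add_sub_cancel, ← mul_sub] at h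
  rw [dvd_sub_comm]
  simpa using h.mul_left ((α⁻¹ : ℤ_[p]ˣ) : ℤ_[p])

/-- Multiplication by a unit permutes the residues modulo `p ^ N`, with inverse given by `α⁻¹`.
Power sums in the representatives of `α⁻¹ b` therefore become power sums in `b`. -/
theorem sum_padicUnitMulRep {M : Type*} [AddCommMonoid M] (α : ℤ_[p]ˣ) (N : ℕ) (g : ℕ → M) :
    ∑ b ∈ Finset.range (p ^ N), g (padicUnitMulRep α N b) = ∑ b ∈ Finset.range (p ^ N), g b := by
  refine Finset.sum_nbij' (padicUnitMulRep α N) (padicUnitMulRep α⁻¹ N)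
    (fun _ _ => Finset.mem_range.2 (padicUnitMulRep_lt _ _ _))
    (fun _ _ => Finset.mem_range.2 (padicUnitMulRep_lt _ _ _))
    (fun b hb => padicUnitMulRep_inv_padicUnitMulRep α (Finset.mem_range.1 hb))
    (fun b hb => ?_) (fun _ _ => rfl)
  simpa using padicUnitMulRep_inv_padicUnitMulRep α⁻¹ (Finset.mem_range.1 hb)

/-- Divisibility by `p ^ N` is unaffected by a unit factor, so residue classes go to residue classes
of the same level; this makes `α_* μ_n` computable on them. -/
theorem unitInvMul_padicResidueClass (α : ℤ_[p]ˣ) (N b : ℕ) :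
    PadicDistribution.unitInvMul α (padicResidueClass p N b)
      = padicResidueClass p N (padicUnitMulRep α⁻¹ N b : ℤ_[p]) := by
  rw [← padicResidueClass_congr (dvd_mul_sub_padicUnitMulRep α⁻¹ N b)]
  refine TopologicalSpace.CompactOpens.ext ?_
  rw [PadicDistribution.coe_unitInvMul]
  ext x
  rw [Set.mem_image]
  simp only [SetLike.mem_coe, mem_padicResidueClass]
  constructor
  · rintro ⟨y, hy, rfl⟩
    rw [← mul_sub]; exact hy.mul_left _
  · intro hx
    refine ⟨(α : ℤ_[p]) * x, ?_, by simp⟩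
    have := hx.mul_left (α : ℤ_[p])
    rwa [mul_sub, Units.mul_inv_cancel_left] at this

/-! ### Limits of power sums twisted by a unit -/

/-- With `c` the representative of `α⁻¹ b`, replacing `b ^ k` by `(α c) ^ k` costs an error
divisible by `p ^ N`. What remains is `α ^ k ∑ c ^ (k + j)`, which is an ordinary power sum after
reindexing. -/
theorem tendsto_sum_pow_mul_padicUnitMulRep_inv_pow (α : ℤ_[p]ˣ) (k j : ℕ) :
    Filter.Tendsto (fun N : ℕ => ∑ b ∈ Finset.range (p ^ N),
      (b : ℚ_[p]) ^ k * (padicUnitMulRep α⁻¹ N b : ℚ_[p]) ^ j) Filter.atTop (nhds 0) := by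
  have h0 := (padic_tendsto_sum_pow p (k + j)).const_mul (((α : ℤ_[p]) : ℚ_[p]) ^ k)
  rw [mul_zero] at h0
  have h1 : Filter.Tendsto (fun N : ℕ => ∑ b ∈ Finset.range (p ^ N),
      ((b : ℚ_[p]) ^ k - (((α : ℤ_[p]) : ℚ_[p]) * (padicUnitMulRep α⁻¹ N b : ℚ_[p])) ^ k) *
        (padicUnitMulRep α⁻¹ N b : ℚ_[p]) ^ j) Filter.atTop (nhds 0) := by
    refine padic_tendsto_zero_of_dvd fun N => ?_
    have h : (p : ℤ_[p]) ^ N ∣ ∑ b ∈ Finset.range (p ^ N),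
      ((b : ℤ_[p]) ^ k - ((α : ℤ_[p]) * (padicUnitMulRep α⁻¹ N b : ℤ_[p])) ^ k) *
        (padicUnitMulRep α⁻¹ N b : ℤ_[p]) ^ j :=
      Finset.dvd_sum fun b _ => ((dvd_sub_mul_padicUnitMulRep_inv α N b).trans
        (sub_dvd_pow_sub_pow _ _ k)).mul_right _
    obtain ⟨z, hz⟩ := h
    refine ⟨z, ?_⟩
    have hcoe : ∀ y : ℤ_[p], PadicInt.Coe.ringHom y = (y : ℚ_[p]) := fun _ => rfl
    have := congrArg (PadicInt.Coe.ringHom : ℤ_[p] →+* ℚ_[p]) hz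
    simp only [map_sum, map_sub, map_mul, map_pow, map_natCast] at this
    simpa only [hcoe] using this
  have h2 := h1.add h0
  rw [add_zero] at h2
  refine h2.congr fun N => ?_
  rw [← sum_padicUnitMulRep α⁻¹ N (fun c => (c : ℚ_[p]) ^ (k + j)), Finset.mul_sum,
    ← Finset.sum_add_distrib]
  exact Finset.sum_congr rfl fun b _ => by ring

/-- The congruence modulo `(x - y) ^ 2`, with `x = b` and `y` equal to `α` times the representative
of `α⁻¹ b`, trades the mixed product for a difference of two pure powers, whose sum is a Volkenborn
sum times `1 - α ^ (k + n)`. -/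
theorem tendsto_inv_pow_mul_sum_pow_mul_sub (α : ℤ_[p]ˣ) (k n : ℕ) :
    Filter.Tendsto (fun N : ℕ => ((p : ℚ_[p]) ^ N)⁻¹ * ∑ b ∈ Finset.range (p ^ N),
      (b : ℚ_[p]) ^ k * ((b : ℚ_[p]) ^ n -
        (((α : ℤ_[p]) : ℚ_[p]) * (padicUnitMulRep α⁻¹ N b : ℚ_[p])) ^ n)) Filter.atTop
      (nhds ((1 - ((α : ℤ_[p]) : ℚ_[p]) ^ (k + n)) *
        (n * ((bernoulli (k + n) / ((k + n : ℕ) : ℚ) : ℚ) : ℚ_[p])))) := by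
  have hp : (p : ℚ_[p]) ≠ 0 := Nat.cast_ne_zero.2 (Fact.out : p.Prime).ne_zero
  -- For `n = 0` both sides vanish; excluding this case makes `k + n` invertible.
  rcases Nat.eq_zero_or_pos n with rfl | hn
  · simp
  have hm : ((k + n : ℕ) : ℚ_[p]) ≠ 0 := Nat.cast_ne_zero.2 (by omega)
  have h0 := (padic_tendsto_inv_pow_mul_sum_pow p (k + n)).const_mul
    ((1 - ((α : ℤ_[p]) : ℚ_[p]) ^ (k + n)) * n)
  have h1 : Filter.Tendsto (fun N : ℕ => ((p : ℚ_[p]) ^ N)⁻¹ * ∑ b ∈ Finset.range (p ^ N),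
      (((k + n : ℕ) : ℚ_[p]) * ((b : ℚ_[p]) ^ k * ((b : ℚ_[p]) ^ n -
        (((α : ℤ_[p]) : ℚ_[p]) * (padicUnitMulRep α⁻¹ N b : ℚ_[p])) ^ n)) -
      n * ((b : ℚ_[p]) ^ (k + n) -
        (((α : ℤ_[p]) : ℚ_[p]) * (padicUnitMulRep α⁻¹ N b : ℚ_[p])) ^ (k + n))))
      Filter.atTop (nhds 0) := by
    refine padic_tendsto_zero_of_dvd fun N => ?_
    -- One factor `p ^ N` absorbs the denominator, the other makes the error tend to `0`.
    have h : ((p : ℤ_[p]) ^ N) ^ 2 ∣ ∑ b ∈ Finset.range (p ^ N),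
        (((k + n : ℕ) : ℤ_[p]) * ((b : ℤ_[p]) ^ k * ((b : ℤ_[p]) ^ n -
          ((α : ℤ_[p]) * (padicUnitMulRep α⁻¹ N b : ℤ_[p])) ^ n)) -
        n * ((b : ℤ_[p]) ^ (k + n) -
          ((α : ℤ_[p]) * (padicUnitMulRep α⁻¹ N b : ℤ_[p])) ^ (k + n))) :=
      Finset.dvd_sum fun b _ => (pow_dvd_pow_of_dvd
        (dvd_sub_mul_padicUnitMulRep_inv α N b) 2).trans (sub_sq_dvd_add_mul_pow_mul_sub _ _ k n)
    obtain ⟨z, hz⟩ := h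
    refine ⟨z, ?_⟩
    have hcoe : ∀ y : ℤ_[p], PadicInt.Coe.ringHom y = (y : ℚ_[p]) := fun _ => rfl
    have := congrArg (PadicInt.Coe.ringHom : ℤ_[p] →+* ℚ_[p]) hz
    simp only [map_sum, map_sub, map_mul, map_pow, map_natCast] at this
    simp only [hcoe] at this
    rw [this]
    field_simp
  have h2 := (h1.add h0).const_mul (((k + n : ℕ) : ℚ_[p])⁻¹)
  convert h2 using 2 with N
  -- Reindexing identifies the two sums of `(k + n)`-th powers up to `α ^ (k + n)`, so the
  -- subtracted part of `h1` cancels against `h0`.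
  · have hs := sum_padicUnitMulRep α⁻¹ N (fun c => (c : ℚ_[p]) ^ (k + n))
    simp only [Finset.sum_sub_distrib, ← Finset.mul_sum, mul_pow _ _ (k + n)]
    rw [hs]
    field_simp
    ring
  · push_cast
    rw [zero_add]
    push_cast at hm
    field_simp

/-! ### Moments of the regularized Bernoulli measure -/

/-- Sorting the Bernoulli polynomial by powers of `p ^ N` isolates the denominator: the exponent `N
(i - 1)` can be negative only for `i = 0`. -/
theorem bernoulliDistribution_residueClass (n N b : ℕ) (hb : b < p ^ N) :
    bernoulliDistribution p n (padicResidueClass p N b)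
      = ∑ i ∈ Finset.range (n + 1), ((bernoulli i * (n.choose i : ℚ) : ℚ) : ℚ_[p]) *
          (p : ℚ_[p]) ^ ((N : ℤ) * ((i : ℤ) - 1)) * (b : ℚ_[p]) ^ (n - i) := by
  have hpQ : (p : ℚ_[p]) ≠ 0 := Nat.cast_ne_zero.2 (Fact.out : p.Prime).ne_zero
  have hp0 : 0 < p := (Fact.out : p.Prime).pos
  have h := bernoulliDistribution_apply p n (b : ℤ) N
  have hfr : Int.fract ((b : ℚ) / (p : ℚ) ^ N) = (b : ℚ) / (p : ℚ) ^ N := by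
    rw [Int.fract_eq_self]
    refine ⟨by positivity, ?_⟩
    rw [div_lt_one (by positivity)]; exact_mod_cast hb
  rw [Int.cast_natCast, Int.cast_natCast, hfr] at h
  rw [h, Polynomial.bernoulli, Polynomial.eval_finsetSum, Finset.mul_sum, Rat.cast_sum]
  refine Finset.sum_congr rfl fun i hi => ?_
  have hin : i ≤ n := Nat.lt_succ_iff.1 (Finset.mem_range.1 hi)
  rw [Polynomial.eval_monomial]
  push_cast
  have e : (p : ℚ_[p]) ^ ((N : ℤ) * ((n : ℤ) - 1))
      = (p : ℚ_[p]) ^ ((N : ℤ) * ((i : ℤ) - 1)) * ((p : ℚ_[p]) ^ N) ^ (n - i) := by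
    rw [← pow_mul, ← zpow_natCast, ← zpow_add₀ hpQ]
    congr 1
    push_cast [Nat.cast_sub hin]; ring
  rw [e, div_pow]
  field_simp

theorem regularizedBernoulliMeasure_residueClass (n : ℕ) (α : ℤ_[p]ˣ) (N b : ℕ)
    (hb : b < p ^ N) :
    (regularizedBernoulliMeasure p n α).toFun (padicResidueClass p N b)
      = ∑ i ∈ Finset.range (n + 1), ((bernoulli i * (n.choose i : ℚ) : ℚ) : ℚ_[p]) *
          ((p : ℚ_[p]) ^ ((N : ℤ) * ((i : ℤ) - 1)) * ((b : ℚ_[p]) ^ (n - i) -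
            ((α : ℤ_[p]) : ℚ_[p]) ^ n * (padicUnitMulRep α⁻¹ N b : ℚ_[p]) ^ (n - i))) := by
  show bernoulliDistribution p n (padicResidueClass p N b) - ((α : ℤ_[p]) : ℚ_[p]) ^ n *
    bernoulliDistribution p n (PadicDistribution.unitInvMul α (padicResidueClass p N b)) = _
  rw [unitInvMul_padicResidueClass, bernoulliDistribution_residueClass n N b hb,
    bernoulliDistribution_residueClass n N _ (padicUnitMulRep_lt _ _ _), Finset.mul_sum,
    ← Finset.sum_sub_distrib]
  exact Finset.sum_congr rfl fun i _ => by ring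

/-- The function `t ↦ t ^ k` on `ℤ_p`. -/
noncomputable def padicMonomial (p : ℕ) [Fact p.Prime] (k : ℕ) : C(ℤ_[p], ℚ_[p]) where
  toFun x := (x : ℚ_[p]) ^ k
  continuous_toFun := by fun_prop

/-- The limit of the Riemann sums is taken separately for each term of the Bernoulli polynomial;
only the leading term, with coefficient `B_0 = 1`, contributes. -/
theorem integral_regularizedBernoulliMeasure_monomial (n : ℕ) (α : ℤ_[p]ˣ) (k : ℕ) :
    (regularizedBernoulliMeasure p n α).integral (padicMonomial p k) =
      (1 - ((α : ℤ_[p]) : ℚ_[p]) ^ (k + n)) *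
        (n * ((bernoulli (k + n) / ((k + n : ℕ) : ℚ) : ℚ) : ℚ_[p])) := by
  refine tendsto_nhds_unique
    ((regularizedBernoulliMeasure p n α).tendsto_riemannSum_integral _) ?_
  -- The contribution of the `i`-th term to the `N`-th Riemann sum, without the coefficient `B_i *
  -- choose n i`.
  set T : ℕ → ℕ → ℚ_[p] := fun i N => (p : ℚ_[p]) ^ ((N : ℤ) * ((i : ℤ) - 1)) *
    ∑ b ∈ Finset.range (p ^ N), (b : ℚ_[p]) ^ k * ((b : ℚ_[p]) ^ (n - i) -
      ((α : ℤ_[p]) : ℚ_[p]) ^ n * (padicUnitMulRep α⁻¹ N b : ℚ_[p]) ^ (n - i)) with hT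
  have hsum : ∀ N, (regularizedBernoulliMeasure p n α).riemannSum (padicMonomial p k) N
      = ∑ i ∈ Finset.range (n + 1), ((bernoulli i * (n.choose i : ℚ) : ℚ) : ℚ_[p]) * T i N := by
    intro N
    have hmon : ∀ b : ℕ, padicMonomial p k (b : ℤ_[p]) = (b : ℚ_[p]) ^ k := fun b => by
      simp [padicMonomial]
    rw [PadicMeasure.riemannSum, Finset.sum_congr rfl fun b hb => by
      rw [regularizedBernoulliMeasure_residueClass n α N b (Finset.mem_range.1 hb), hmon,
        Finset.mul_sum], Finset.sum_comm]
    refine Finset.sum_congr rfl fun i _ => ?_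
    rw [hT]
    simp only [Finset.mul_sum]
    exact Finset.sum_congr rfl fun b _ => by ring
  have hT0 : Filter.Tendsto (T 0) Filter.atTop (nhds ((1 - ((α : ℤ_[p]) : ℚ_[p]) ^ (k + n)) *
        (n * ((bernoulli (k + n) / ((k + n : ℕ) : ℚ) : ℚ) : ℚ_[p])))) := by
    refine (tendsto_inv_pow_mul_sum_pow_mul_sub α k n).congr fun N => ?_
    simp only [hT, Nat.sub_zero, mul_pow, Nat.cast_zero, zero_sub, mul_neg, mul_one, zpow_neg,
      zpow_natCast]
  have hTi : ∀ i, i ≠ 0 → Filter.Tendsto (T i) Filter.atTop (nhds 0) := by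
    intro i hi
    obtain ⟨j, rfl⟩ := Nat.exists_eq_succ_of_ne_zero hi
    have h := (padic_tendsto_sum_pow p (k + (n - (j + 1)))).sub
      ((tendsto_sum_pow_mul_padicUnitMulRep_inv_pow α k (n - (j + 1))).const_mul
        (((α : ℤ_[p]) : ℚ_[p]) ^ n))
    rw [mul_zero, sub_zero] at h
    -- The weight `p ^ (N j)`, with `i = j + 1`, has norm at most `1`, so it suffices that the
    -- unweighted sum tends to `0`.
    refine squeeze_zero_norm (fun N => ?_) (tendsto_zero_iff_norm_tendsto_zero.1 h)
    have e : (p : ℚ_[p]) ^ ((N : ℤ) * (((j + 1 : ℕ) : ℤ) - 1)) = (p : ℚ_[p]) ^ (N * j) := by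
      rw [← zpow_natCast]; congr 1; push_cast; ring
    simp only [hT, Nat.succ_eq_add_one]
    rw [e, norm_mul]
    have e2 : ∑ b ∈ Finset.range (p ^ N), (b : ℚ_[p]) ^ k * ((b : ℚ_[p]) ^ (n - (j + 1)) -
        ((α : ℤ_[p]) : ℚ_[p]) ^ n * (padicUnitMulRep α⁻¹ N b : ℚ_[p]) ^ (n - (j + 1)))
        = ∑ b ∈ Finset.range (p ^ N), (b : ℚ_[p]) ^ (k + (n - (j + 1))) -
          ((α : ℤ_[p]) : ℚ_[p]) ^ n * ∑ b ∈ Finset.range (p ^ N),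
            (b : ℚ_[p]) ^ k * (padicUnitMulRep α⁻¹ N b : ℚ_[p]) ^ (n - (j + 1)) := by
      rw [Finset.mul_sum, ← Finset.sum_sub_distrib]
      exact Finset.sum_congr rfl fun b _ => by ring
    rw [e2]
    refine mul_le_of_le_one_left (norm_nonneg _) ?_
    rw [norm_pow]
    exact pow_le_one₀ (norm_nonneg _) Padic.norm_p_lt_one.le
  have hlim := tendsto_finsetSum (Finset.range (n + 1)) fun i _ =>
    (show Filter.Tendsto (T i) Filter.atTop (nhds (if i = 0 then
      (1 - ((α : ℤ_[p]) : ℚ_[p]) ^ (k + n)) *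
        (n * ((bernoulli (k + n) / ((k + n : ℕ) : ℚ) : ℚ) : ℚ_[p])) else 0)) by
      split_ifs with h
      · rw [h]; exact hT0
      · exact hTi i h).const_mul ((bernoulli i * (n.choose i : ℚ) : ℚ) : ℚ_[p])
  simp only [mul_ite, mul_zero, Finset.sum_ite_eq', Finset.mem_range, Nat.succ_pos, if_true,
    bernoulli_zero, Nat.choose_zero_right, Nat.cast_one, mul_one, Rat.cast_one, one_mul] at hlim
  exact hlim.congr fun N => (hsum N).symm

end UnitInverse

/-! ### From monomials to overconvergent functions -/

namespace Overconvergent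

variable {p : ℕ} [Fact p.Prime]

/-- The power series of an overconvergent function converges uniformly on `ℤ_p`. -/
theorem hasSum_toContinuousMap (f : Overconvergent p) :
    HasSum (fun k => f.coeff k • padicMonomial p k) f.toContinuousMap := by
  have hs : Summable fun k => f.coeff k • padicMonomial p k := by
    obtain ⟨ρ, g, rfl⟩ := f.exists_eq_ofAnalytic
    have hρ1 : (1 : ℝ) < ρ := ρ.2
    have hρ : (0 : ℝ) < ρ := zero_lt_one.trans hρ1
    -- Since `‖a_k‖ ρ ^ k ≤ ‖g‖` and `‖t ^ k‖ ≤ 1` on `ℤ_p`, the geometric series of ratio `ρ⁻¹ < 1`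
    -- is a majorant in the sup norm.
    refine Summable.of_norm_bounded (g := fun k => ‖g‖ * ((ρ : ℝ)⁻¹) ^ k)
      ((summable_geometric_of_lt_one (inv_pos.2 hρ).le (inv_lt_one_of_one_lt₀ hρ1)).mul_left _)
      fun k => ?_
    rw [coeff_ofAnalytic, ContinuousMap.norm_le _ (by positivity)]
    intro x
    rw [ContinuousMap.smul_apply, norm_smul, inv_pow, ← div_eq_mul_inv, le_div_iff₀ (by positivity)]
    refine le_trans ?_ (g.le_norm k)
    refine mul_le_mul_of_nonneg_right (mul_le_of_le_one_right (norm_nonneg _) ?_) (by positivity)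
    show ‖(x : ℚ_[p]) ^ k‖ ≤ 1
    rw [norm_pow]
    exact pow_le_one₀ (norm_nonneg _) x.2
  have h : ∑' k, f.coeff k • padicMonomial p k = f.toContinuousMap := by
    ext x
    -- Evaluation at `x` is continuous, so the uniform sum agrees pointwise with the given power
    -- series.
    exact (hs.hasSum.mapL (ContinuousMap.evalCLM ℚ_[p] x)).unique (f.hasPadicPowerSeries_coeff x)
  exact h ▸ hs.hasSum

theorem coeff_dilate (α : ℤ_[p]ˣ) (f : Overconvergent p) (k : ℕ) :
    (dilate α f).coeff k = ((α : ℤ_[p]) : ℚ_[p]) ^ k * f.coeff k := by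
  refine congrFun (HasPadicPowerSeries.padicCoeff_eq
    (a := fun k => ((α : ℤ_[p]) : ℚ_[p]) ^ k * f.coeff k) fun x => ?_) k
  have h := f.hasPadicPowerSeries_coeff ((α : ℤ_[p]) * x)
  show HasSum _ (f.1 ((α : ℤ_[p]) * x))
  convert h using 2 with k
  push_cast
  ring

end Overconvergent

/-- Integration is continuous for the sup norm, so it may be applied termwise to the uniformly
convergent series of `f`; the Bernoulli functionals are series in the coefficients by definition. It
remains to compare the `k`-th terms, which is the moment formula. -/
theorem proposition2p7 (p : ℕ) [Fact p.Prime] (n : ℕ) (α : ℤ_[p]ˣ) :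
    (regularizedBernoulliMeasure p n α).integral.comp Overconvergent.toContinuousMap =
      bernoulliFunctional p n -
        ((α : ℤ_[p]) : ℚ_[p]) ^ n • (bernoulliFunctional p n).comp (Overconvergent.dilate α) := by
  ext f
  have h1 := f.hasSum_toContinuousMap.mapL (regularizedBernoulliMeasure p n α).integral
  have h2 := (hasSum_bernoulliFunctional p n f).sub
    ((hasSum_bernoulliFunctional p n (Overconvergent.dilate α f)).mul_left
      (((α : ℤ_[p]) : ℚ_[p]) ^ n))
  refine h1.unique (Eq.mp (congrArg (HasSum · _) (funext fun k => ?_)) h2)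
  rw [map_smul, integral_regularizedBernoulliMeasure_monomial, Overconvergent.coeff_dilate,
    smul_eq_mul]
  ring
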